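/- Let $\theta>0$, let $n,J$ be natural numbers with $J\ge 1$, and let $G_0$ be a nonatomic probability measure on a measurable space $\mathbb S$ whose $\sigma$-algebra contains a countable family of sets separating points (for instance a standard Borel space). Let $P\sim\mathrm{DP}(\theta,G_0)$ be a Dirichlet process, i.e. a random probability measure on $\mathbb S$ such that $(P(B_1),\dots,P(B_k))\sim\mathrm{Dir}(\theta G_0(B_1),\dots,\theta G_0(B_k))$ for every finite measurable partition $B_1,\dots,B_k$ of $\mathbb S$. Given $P$, let $X_1,\dots,X_n,X_{n+1}$ be i.i.d. with law $P$. Let $h:\mathbb S\to\{1,\dots,J\}$ be a random hash function from a pairwise independent family, i.e. $\Pr[h(x_1)=j_1,\,h(x_2)=j_2]=J^{-2}$ for all fixed $x_1\ne x_2$ and all $j_1,j_2$, independent of $(P,X_1,\dots,X_{n+1})$, in the sense that, conditionally on $P$ and on $X_i=x_i$ for all $i$, the vector $(h(X_1),\dots,h(X_{n+1}))$ has the law of $(h(x_1),\dots,h(x_{n+1}))$ for the fixed points $x_i$ (the probabilities $\Pr[h(x_i)=v_i\ \forall i]$ being measurable in $(x_1,\dots,x_{n+1})$). Put $$C_j=\sum_{i=1}^n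 I(h(X_i)=j),\qquad \mathbf C_J=(C_1,\dots,C_J),\qquad f_{X_{n+1}}=\sum_{i=1}^n I(X_i=X_{n+1}).$$ Let $\mathbf c=(c_1,\dots,c_J)$ be nonnegative integers with $\sum_k c_k=n$ and let $j\in\{1,\dots,J\}$. Then $\Pr[\mathbf C_J=\mathbf c,\ h(X_{n+1})=j]>0$ and the following hold. (1) For all $l\in\{0,1,\dots,c_j\}$, with $(a)_{(m)}=\prod_{0\le i\le m-1}(a+i)$, $$\Pr[f_{X_{n+1}}=l\mid \mathbf C_J=\mathbf c,\ h(X_{n+1})=j]=\frac{\theta}{J}\,\frac{(c_j-l+1)_{(l)}}{\left(\frac{\theta}{J}+c_j-l\right)_{(l+1)}}.$$ This is also the value of the general Poisson--Kingman posterior formula at the (untilted) Gamma completely random measure: with $\rho(s)=s^{-1}e^{-s}$, $\psi(u)=\int_0^\infty(1-e^{-us})\rho(s)\,ds$, $\phi^{(m)}(u)=(-1)^m\frac{d^m}{du^m}e^{-\frac{\theta}{J}\psi(u)}$ and $\kappa(u,m)=\int_0^\infty e^{-us}s^m\rho(s)\,ds$, the same probability equals $$\frac{\theta}{J}\binom{c_j}{l}\frac{\int_0^\infty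 u^{n}\,\phi^{(c_j-l)}(u)\prod_{k\ne j}\phi^{(c_k)}(u)\,\kappa(u,l+1)\,du}{\int_0^\infty u^{n}\,\phi^{(c_j+1)}(u)\prod_{k\ne j}\phi^{(c_k)}(u)\,du}.$$ (2) This posterior is the Beta-Binomial distribution with $c_j$ trials and mixing law $\mathrm{Beta}(1,\theta/J)$: for every integer $l\ge 0$, $$\Pr[f_{X_{n+1}}=l\mid \mathbf C_J=\mathbf c,\ h(X_{n+1})=j]=\int \binom{c_j}{l}p^l(1-p)^{c_j-l}\,\mathrm{Beta}(1,\theta/J)(dp),$$ where the integrand is $0$ for $l>c_j$. (3) The posterior depends on the sketch only through the count in the bucket of $X_{n+1}$: for every integer $l\ge0$, $$\Pr[f_{X_{n+1}}=l\mid \mathbf C_J=\mathbf c,\ h(X_{n+1})=j]=\Pr[f_{X_{n+1}}=l\mid C_{h(X_{n+1})}=c_j].$$ -/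

import Mathlib

open MeasureTheory ProbabilityTheory
open scoped ENNReal

/-! ## The Dirichlet distribution and the Dirichlet process -/

/-- The `Gamma(a, 1)` law for `a > 0`; for `a = 0` it is, as usual, the point mass at `0`. -/
noncomputable def gammaLaw (a : ℝ) : Measure ℝ :=
  if 0 < a then gammaMeasure a 1 else Measure.dirac 0

instance gammaLaw_isProbabilityMeasure (a : ℝ) : IsProbabilityMeasure (gammaLaw a) := by
  unfold gammaLaw
  split_ifs with h
  · exact isProbabilityMeasure_gammaMeasure h one_pos
  · infer_instance

/-- The Dirichlet distribution with parameters `a i ≥ 0`, not all zero: the law of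
`(Y i / ∑ k, Y k)ᵢ`, where the `Y i` are independent with `Y i ∼ Gamma(a i, 1)`
(so that a coordinate with parameter `0` is almost surely `0`). -/
noncomputable def dirichletLaw {ι : Type*} [Fintype ι] (a : ι → ℝ) : Measure (ι → ℝ) :=
  (Measure.pi fun i => gammaLaw (a i)).map fun y i => y i / ∑ k, y k

/-- `P ∼ DP(θ, G₀)`: the random probability measure `P` has Dirichlet finite-dimensional laws,
`(P(B₁), …, P(B_k)) ∼ Dir(θ G₀(B₁), …, θ G₀(B_k))` for each finite measurable partition. -/
structure IsDirichletProcess {Ω S : Type*} [MeasurableSpace Ω] [MeasurableSpace S]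
    (μ : Measure Ω) (θ : ℝ) (G₀ : Measure S) (P : Ω → Measure S) : Prop where
  measurable : Measurable P
  isProbabilityMeasure : ∀ ω, IsProbabilityMeasure (P ω)
  map_partition : ∀ (k : ℕ) (B : Fin k → Set S), (∀ i, MeasurableSet (B i)) →
    Pairwise (fun i i' => Disjoint (B i) (B i')) → (⋃ i, B i) = Set.univ →
    μ.map (fun ω i => (P ω).real (B i)) = dirichletLaw fun i => θ * G₀.real (B i)

/-! ## The sampling and hashing model -/

/-- Given the random probability measure `P`, the `X i` are independent with common law `P`. -/
structure IsSampleFrom {Ω S : Type*} [MeasurableSpace Ω] [MeasurableSpace S] {m : ℕ}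
    (μ : Measure Ω) (P : Ω → Measure S) (X : Fin m → Ω → S) : Prop where
  measurable : ∀ i, Measurable (X i)
  cond_iid : ∀ (B : Set (Measure S)) (A : Fin m → Set S), MeasurableSet B →
    (∀ i, MeasurableSet (A i)) →
    μ {ω | P ω ∈ B ∧ ∀ i, X i ω ∈ A i} = ∫⁻ ω in {ω | P ω ∈ B}, ∏ i, P ω (A i) ∂μ

/-- `h` is a random map from `S` to `J` buckets drawn from a pairwise independent (strongly
universal) family: `Pr[h(x₁) = j₁, h(x₂) = j₂] = 1 / J²` for all fixed `x₁ ≠ x₂`. -/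
structure IsPairwiseIndependentHash {Ω S : Type*} [MeasurableSpace Ω] {J : ℕ}
    (μ : Measure Ω) (h : Ω → S → Fin J) : Prop where
  measurable : ∀ x, Measurable fun ω => h ω x
  pairwise : ∀ x₁ x₂ : S, x₁ ≠ x₂ → ∀ j₁ j₂ : Fin J,
    μ.real {ω | h ω x₁ = j₁ ∧ h ω x₂ = j₂} = 1 / (J : ℝ) ^ 2

/-- The random hash function `h` is independent of `P` and of the sample `X`: conditionally on
`P` and on `X = x`, the hash values `h(X 1), …, h(X m)` have the law that `h(x 1), …, h(x m)` has
for the fixed points `x 1, …, x m`.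
If `(ω, x) ↦ h ω x` is jointly measurable, this follows from ordinary independence by Fubini.
Joint measurability is not assumed: for `J ≥ 2` a pairwise independent `h` can not have it when
`S` carries a nonatomic probability measure. -/
structure IsHashIndependentOfSample {Ω S : Type*} [MeasurableSpace Ω] [MeasurableSpace S]
    {m J : ℕ} (μ : Measure Ω) (P : Ω → Measure S) (X : Fin m → Ω → S)
    (h : Ω → S → Fin J) : Prop where
  measurable_hash : ∀ i, Measurable fun ω => h ω (X i ω)
  measurable_prob : ∀ v : Fin m → Fin J,
    Measurable fun x : Fin m → S => μ {ω | ∀ i, h ω (x i) = v i}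
  subst : ∀ (A : Set (Measure S × (Fin m → S))) (v : Fin m → Fin J), MeasurableSet A →
    μ {ω | (P ω, fun i => X i ω) ∈ A ∧ ∀ i, h ω (X i ω) = v i} =
      ∫⁻ ω in {ω | (P ω, fun i => X i ω) ∈ A}, μ {ω' | ∀ i, h ω' (X i ω) = v i} ∂μ

/-- The sketch of the first `n` of the `n + 1` data points: `C j = #{i ≤ n | h(Xᵢ) = j}`. -/
def sketch {Ω S : Type*} {n J : ℕ} (h : Ω → S → Fin J) (X : Fin (n + 1) → Ω → S)
    (ω : Ω) (j : Fin J) : ℕ :=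
  (Finset.univ.filter fun i : Fin n => h ω (X i.castSucc ω) = j).card

/-- The bucket `h(Xₙ₊₁)` of the last data point. -/
def queryBucket {Ω S : Type*} {n J : ℕ} (h : Ω → S → Fin J) (X : Fin (n + 1) → Ω → S)
    (ω : Ω) : Fin J :=
  h ω (X (Fin.last n) ω)

open Classical in
/-- The empirical frequency of `Xₙ₊₁` in `X₁, …, Xₙ`. -/
noncomputable def queryFrequency {Ω S : Type*} {n : ℕ} (X : Fin (n + 1) → Ω → S) (ω : Ω) : ℕ :=
  (Finset.univ.filter fun i : Fin n => X i.castSucc ω = X (Fin.last n) ω).card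

/-! ## Closed forms -/

/-- The rising factorial `(a)₍ₘ₎ = a (a + 1) ⋯ (a + m - 1)`. -/
noncomputable def risingFactorial (a : ℝ) (m : ℕ) : ℝ :=
  ∏ i ∈ Finset.range m, (a + i)

/-- The Beta-Binomial mass function: a binomial with `c` trials whose success probability is
drawn from the `Beta(a, b)` law. -/
noncomputable def betaBinomialMass (c : ℕ) (a b : ℝ) (l : ℕ) : ℝ :=
  ∫ p, (c.choose l : ℝ) * p ^ l * (1 - p) ^ (c - l) ∂(betaMeasure a b)

/-- `ψ(u) = ∫₀^∞ (1 - e^{-us}) ρ(s) ds`. -/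
noncomputable def levyExponent (ρ : ℝ → ℝ) (u : ℝ) : ℝ :=
  ∫ s in Set.Ioi 0, (1 - Real.exp (-(u * s))) * ρ s

/-- `κ(u, m) = ∫₀^∞ e^{-us} s^m ρ(s) ds`. -/
noncomputable def levyMoment (ρ : ℝ → ℝ) (u : ℝ) (m : ℕ) : ℝ :=
  ∫ s in Set.Ioi 0, Real.exp (-(u * s)) * s ^ m * ρ s

/-- `φ⁽ᵐ⁾(u) = (-1)^m (d/du)^m e^{-a ψ(u)}`. -/
noncomputable def levyPhi (ρ : ℝ → ℝ) (a : ℝ) (m : ℕ) (u : ℝ) : ℝ :=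
  (-1) ^ m * iteratedDeriv m (fun z => Real.exp (-(a * levyExponent ρ z))) u

/-- The posterior mass function of the empirical frequency for a Poisson-Kingman prior with Lévy
intensity `θ ρ(s) ds G₀(dx)` and tilting `g(t) ∝ t^{-γ} e^{-β t}`. -/
noncomputable def pkPosterior (θ : ℝ) (ρ : ℝ → ℝ) (γ β : ℝ) {J : ℕ} (n : ℕ) (c : Fin J → ℕ)
    (j : Fin J) (l : ℕ) : ℝ :=
  θ / J * ((c j).choose l : ℝ) *
    ((∫ u in Set.Ioi 0, u ^ ((n : ℝ) + γ) * levyPhi ρ (θ / J) (c j - l) (u + β) *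
        (∏ k ∈ Finset.univ.erase j, levyPhi ρ (θ / J) (c k) (u + β)) *
          levyMoment ρ (u + β) (l + 1)) /
      ∫ u in Set.Ioi 0, u ^ ((n : ℝ) + γ) * levyPhi ρ (θ / J) (c j + 1) (u + β) *
        ∏ k ∈ Finset.univ.erase j, levyPhi ρ (θ / J) (c k) (u + β))

/-- The Lévy density of the Gamma completely random measure. -/
noncomputable def gammaLevyDensity (s : ℝ) : ℝ :=
  s⁻¹ * Real.exp (-s)

/-! ## Rising factorials and Gamma integrals -/

/-! A sample from a Dirichlet process has the Blackwell-MacQueen law: i.i.d. `G₀` values attached to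
the labels of a Hoppe urn (`map_sample_eq_blackwellMacQueenLaw`). On a finite partition this
compares two numbers, a mixed moment of the Dirichlet law (`lintegral_prod_dirichletLaw`) and a box
probability of the urn (`lintegral_labelledBoxProb_hoppeLaw`). Both equal the Pólya urn probability
`polyaProb`.

As `G₀` is nonatomic, distinct labels almost surely carry distinct values, so ties in the data are
ties of labels. Pairwise independence of the hash then becomes full independence on average over
these values. Indeed any one point can be exchanged for any of `N` fresh i.i.d. points, and the
number of those in a given bucket differs from `N / J` by order `√N` in mean, on whatever event
describes the other hash values (`IsPairwiseIndependentHash.integral_measureReal_lt`). Hence labels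
and hash values together form a Hoppe urn whose base law is uniform on the `J` buckets.

By exchangeability the query point may be taken as the first draw of this urn. Inside its bucket
every later draw either joins its block or does not: a two-colour Pólya urn started with weights `1`
and `θ / J`. So the joint probability of a hash vector `v` and a frequency `l` is `polyaBlockMass (θ
/ J) c l * polyaProb (fun _ => θ / J) v`, where `c` is the number of earlier points in the query
bucket (`lintegral_lastMultiplicity_hoppeLaw`). The first factor sees `v` only through `c`, which
both conditioning events fix; conditioning therefore leaves `polyaBlockMass`. The closed form, the
Beta-Binomial integral and the Poisson-Kingman quotient are three evaluations of it. -/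

@[simp]
lemma risingFactorial_zero (a : ℝ) : risingFactorial a 0 = 1 := by
  simp [risingFactorial]

lemma risingFactorial_succ (a : ℝ) (m : ℕ) :
    risingFactorial a (m + 1) = risingFactorial a m * (a + m) := by
  simp [risingFactorial, Finset.prod_range_succ]

lemma risingFactorial_nonneg {a : ℝ} (ha : 0 ≤ a) (m : ℕ) : 0 ≤ risingFactorial a m :=
  Finset.prod_nonneg fun _ _ => by positivity

lemma risingFactorial_pos {a : ℝ} (ha : 0 < a) (m : ℕ) : 0 < risingFactorial a m :=
  Finset.prod_pos fun _ _ => by positivity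

lemma risingFactorial_add (a : ℝ) (m k : ℕ) :
    risingFactorial a (m + k) = risingFactorial a m * risingFactorial (a + m) k := by
  simp only [risingFactorial, Finset.prod_range_add]
  congr 1
  exact Finset.prod_congr rfl fun i _ => by push_cast; ring

lemma Gamma_add_nat {a : ℝ} (ha : 0 < a) (m : ℕ) :
    Real.Gamma (a + m) = risingFactorial a m * Real.Gamma a := by
  induction m with
  | zero => simp
  | succ m ih =>
    rw [Nat.cast_succ, ← add_assoc, Real.Gamma_add_one (by positivity), ih, risingFactorial_succ]
    ring

lemma lintegral_rpow_mul_exp_neg_mul_Ioi {a r : ℝ} (ha : 0 < a) (hr : 0 < r) :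
    ∫⁻ t in Set.Ioi (0 : ℝ), ENNReal.ofReal (t ^ (a - 1) * Real.exp (-(r * t))) =
      ENNReal.ofReal (r ^ (-a) * Real.Gamma a) := by
  have hval := Real.integral_rpow_mul_exp_neg_mul_Ioi ha hr
  have hpow : (1 / r) ^ a = r ^ (-a) := by
    rw [Real.rpow_neg hr.le, one_div, Real.inv_rpow hr.le]
  rw [hpow] at hval
  rw [← hval, ofReal_integral_eq_lintegral_ofReal]
  -- The Bochner integral of a nonintegrable function is `0`, so a nonzero value certifies
  -- integrability.
  · refine Integrable.of_integral_ne_zero ?_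
    rw [hval]
    have := Real.Gamma_pos_of_pos ha
    positivity
  · filter_upwards [ae_restrict_mem measurableSet_Ioi] with t ht
    have : (0 : ℝ) < t := ht
    simp only [Pi.zero_apply]
    positivity

lemma lintegral_gammaLaw {a : ℝ} (ha : 0 < a) {f : ℝ → ℝ≥0∞} (hf : Measurable f) :
    ∫⁻ y, f y ∂(gammaLaw a) = ∫⁻ t in Set.Ioi (0 : ℝ),
      ENNReal.ofReal ((Real.Gamma a)⁻¹ * t ^ (a - 1) * Real.exp (-t)) * f t := by
  have hm : Measurable (gammaPDF a 1) := (measurable_gammaPDFReal a 1).ennreal_ofReal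
  rw [gammaLaw, if_pos ha, gammaMeasure, lintegral_withDensity_eq_lintegral_mul _ hm hf,
    ← lintegral_add_compl _ (measurableSet_Iio (a := (0 : ℝ)))]
  rw [setLIntegral_congr_fun (g := fun _ => 0) measurableSet_Iio, lintegral_zero, zero_add,
    Set.compl_Iio, setLIntegral_congr Ioi_ae_eq_Ici.symm]
  · refine setLIntegral_congr_fun measurableSet_Ioi fun t ht => ?_
    have ht' : (0 : ℝ) < t := ht
    simp [gammaPDF_of_nonneg ht'.le]
  · intro t ht
    simp [gammaPDF_of_neg (show t < 0 from ht)]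

lemma lintegral_pow_mul_exp_gammaLaw {a u : ℝ} (ha : 0 ≤ a) (hu : 0 ≤ u) (n : ℕ) :
    ∫⁻ y, ENNReal.ofReal (y ^ n * Real.exp (-(u * y))) ∂(gammaLaw a) =
      ENNReal.ofReal (risingFactorial a n * (1 + u) ^ (-(a + n))) := by
  -- A box of mass zero gives parameter `0`, where the law is the point mass at `0`; for `n > 0`
  -- both sides vanish.
  rcases ha.eq_or_lt with rfl | ha
  · rw [gammaLaw, if_neg (lt_irrefl _), lintegral_dirac' _ (by fun_prop)]
    rcases n with _ | n
    · simp
    · simp [risingFactorial, Finset.prod_range_succ']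
  rw [lintegral_gammaLaw ha (by fun_prop)]
  have hΓ := Real.Gamma_pos_of_pos ha
  have key : ∀ t ∈ Set.Ioi (0 : ℝ),
      ENNReal.ofReal ((Real.Gamma a)⁻¹ * t ^ (a - 1) * Real.exp (-t)) *
          ENNReal.ofReal (t ^ n * Real.exp (-(u * t))) =
        ENNReal.ofReal (Real.Gamma a)⁻¹ *
          ENNReal.ofReal (t ^ (a + n - 1) * Real.exp (-((1 + u) * t))) := by
    intro t ht
    have ht' : (0 : ℝ) < t := ht
    rw [← ENNReal.ofReal_mul (by positivity), ← ENNReal.ofReal_mul (by positivity)]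
    congr 1
    rw [show a + n - 1 = (a - 1) + n by ring, Real.rpow_add_natCast ht'.ne',
      show -((1 + u) * t) = -t + -(u * t) by ring, Real.exp_add]
    ring
  rw [setLIntegral_congr_fun measurableSet_Ioi key, lintegral_const_mul' _ _ (by simp),
    lintegral_rpow_mul_exp_neg_mul_Ioi (by positivity) (by positivity),
    ← ENNReal.ofReal_mul (by positivity), Gamma_add_nat ha]
  congr 1
  field_simp

/-- A beta-prime integral: write `(1 + u) ^ (-(A + p))` as a Gamma integral in `t` and integrate
over `u` first. -/
lemma lintegral_rpow_mul_one_add_rpow {p A : ℝ} (hp : 0 < p) (hA : 0 < A) :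
    ∫⁻ u in Set.Ioi (0 : ℝ), ENNReal.ofReal (u ^ (p - 1) * (1 + u) ^ (-(A + p))) =
      ENNReal.ofReal (Real.Gamma p * Real.Gamma A / Real.Gamma (A + p)) := by
  have hB : 0 < A + p := by positivity
  have hΓp := Real.Gamma_pos_of_pos hp
  have hΓA := Real.Gamma_pos_of_pos hA
  have hΓ := Real.Gamma_pos_of_pos hB
  have h1 : ∀ u ∈ Set.Ioi (0 : ℝ), ENNReal.ofReal (u ^ (p - 1) * (1 + u) ^ (-(A + p))) =
      ∫⁻ t in Set.Ioi (0 : ℝ), ENNReal.ofReal ((Real.Gamma (A + p))⁻¹ * u ^ (p - 1)) *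
        ENNReal.ofReal (t ^ (A + p - 1) * Real.exp (-((1 + u) * t))) := by
    intro u hu
    have hu' : (0 : ℝ) < u := hu
    rw [lintegral_const_mul' _ _ (by simp), lintegral_rpow_mul_exp_neg_mul_Ioi hB (by positivity),
      ← ENNReal.ofReal_mul (by positivity)]
    congr 1
    field_simp
  rw [setLIntegral_congr_fun measurableSet_Ioi h1, lintegral_lintegral_swap (by fun_prop)]
  have h2 : ∀ t ∈ Set.Ioi (0 : ℝ), (∫⁻ u in Set.Ioi (0 : ℝ),
      ENNReal.ofReal ((Real.Gamma (A + p))⁻¹ * u ^ (p - 1)) *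
        ENNReal.ofReal (t ^ (A + p - 1) * Real.exp (-((1 + u) * t)))) =
      ENNReal.ofReal (Real.Gamma p / Real.Gamma (A + p)) *
        ENNReal.ofReal (t ^ (A - 1) * Real.exp (-(1 * t))) := by
    intro t ht
    have ht' : (0 : ℝ) < t := ht
    have h3 : ∀ u ∈ Set.Ioi (0 : ℝ), ENNReal.ofReal ((Real.Gamma (A + p))⁻¹ * u ^ (p - 1)) *
        ENNReal.ofReal (t ^ (A + p - 1) * Real.exp (-((1 + u) * t))) =
        ENNReal.ofReal ((Real.Gamma (A + p))⁻¹ * t ^ (A + p - 1) * Real.exp (-t)) *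
          ENNReal.ofReal (u ^ (p - 1) * Real.exp (-(t * u))) := by
      intro u hu
      have hu' : (0 : ℝ) < u := hu
      rw [← ENNReal.ofReal_mul (by positivity), ← ENNReal.ofReal_mul (by positivity)]
      congr 1
      rw [show -((1 + u) * t) = -t + -(t * u) by ring, Real.exp_add]
      ring
    rw [setLIntegral_congr_fun measurableSet_Ioi h3, lintegral_const_mul' _ _ (by simp),
      lintegral_rpow_mul_exp_neg_mul_Ioi hp ht', ← ENNReal.ofReal_mul (by positivity),
      ← ENNReal.ofReal_mul (by positivity)]
    congr 1
    rw [show A - 1 = (A + p - 1) + (-p) by ring, Real.rpow_add ht', one_mul]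
    field_simp
  rw [setLIntegral_congr_fun measurableSet_Ioi h2, lintegral_const_mul' _ _ (by simp),
    lintegral_rpow_mul_exp_neg_mul_Ioi hA one_pos, ← ENNReal.ofReal_mul (by positivity)]
  congr 1
  rw [Real.one_rpow]
  field_simp

/-! ## Moments of the Dirichlet distribution -/

lemma ae_nonneg_gammaLaw (a : ℝ) : ∀ᵐ y ∂(gammaLaw a), 0 ≤ y := by
  by_cases ha : 0 < a
  · have : (gammaLaw a) (Set.Iio 0) = 0 := by
      rw [gammaLaw, if_pos ha, gammaMeasure, withDensity_apply _ measurableSet_Iio,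
        lintegral_gammaPDF_of_nonpos le_rfl]
    rw [ae_iff]
    simpa [Set.Iio] using this
  · rw [gammaLaw, if_neg ha, ae_dirac_iff measurableSet_Ici]

/-- For a word `f` in a finite alphabet `κ` with letter weights `a`, the probability that the
Pólya urn produces `f`. -/
noncomputable def polyaProb {κ : Type*} [Fintype κ] [DecidableEq κ] (a : κ → ℝ) {m : ℕ}
    (f : Fin m → κ) : ℝ :=
  (∏ k, risingFactorial (a k) (Finset.univ.filter fun i => f i = k).card) /
    risingFactorial (∑ k, a k) m

lemma prod_comp_fin {κ : Type*} [Fintype κ] [DecidableEq κ] {M : Type*} [CommMonoid M] {m : ℕ}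
    (f : Fin m → κ) (g : κ → M) :
    ∏ i, g (f i) = ∏ k, g k ^ (Finset.univ.filter fun i => f i = k).card := by
  rw [← Finset.prod_fiberwise Finset.univ f]
  refine Finset.prod_congr rfl fun k _ => ?_
  rw [Finset.prod_congr rfl (g := fun _ => g k) (by simp +contextual), Finset.prod_const]

/-- Trades the normalisation of the Dirichlet law for exponentials `exp (-(u * y k))`, which
factorise over the independent Gamma variables. -/
lemma inv_pow_eq_lintegral {s : ℝ} (hs : 0 < s) {m : ℕ} (hm : 0 < m) :
    ENNReal.ofReal ((s ^ m)⁻¹) = ENNReal.ofReal ((Real.Gamma m)⁻¹) *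
      ∫⁻ u in Set.Ioi (0 : ℝ), ENNReal.ofReal (u ^ ((m : ℝ) - 1) * Real.exp (-(s * u))) := by
  have hm' : (0 : ℝ) < m := by exact_mod_cast hm
  have := Real.Gamma_pos_of_pos hm'
  rw [lintegral_rpow_mul_exp_neg_mul_Ioi hm' hs, ← ENNReal.ofReal_mul (by positivity),
    Real.rpow_neg hs.le, Real.rpow_natCast]
  congr 1
  field_simp

/-- After `inv_pow_eq_lintegral` and Tonelli, the expectation at fixed `u` is a product of
one-dimensional Gamma moments. The powers of `1 + u` collect into a single beta-prime integral. -/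
lemma lintegral_prod_dirichletLaw {κ : Type*} [Fintype κ] [DecidableEq κ] {a : κ → ℝ}
    (ha : ∀ k, 0 ≤ a k) (hA : 0 < ∑ k, a k) {m : ℕ} (f : Fin m → κ) :
    ∫⁻ z, ∏ i, ENNReal.ofReal (z (f i)) ∂(dirichletLaw a) = ENNReal.ofReal (polyaProb a f) := by
  have hprob : IsProbabilityMeasure (dirichletLaw a) := by
    unfold dirichletLaw
    exact Measure.isProbabilityMeasure_map (by fun_prop)
  rcases Nat.eq_zero_or_pos m with rfl | hm
  · simp [polyaProb]
  have hm' : (0 : ℝ) < m := by exact_mod_cast hm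
  set N : κ → ℕ := fun k => (Finset.univ.filter fun i => f i = k).card with hN
  have hNsum : ∑ k, N k = m := by
    simp only [hN]
    rw [← Finset.card_eq_sum_card_fiberwise (fun _ _ => Finset.mem_univ _)]
    simp
  have hnn : ∀ᵐ y ∂(Measure.pi fun i => gammaLaw (a i)), ∀ i, 0 ≤ y i := by
    rw [ae_all_iff]
    intro i
    exact (Measure.quasiMeasurePreserving_eval (fun i => gammaLaw (a i)) i).ae
      (ae_nonneg_gammaLaw (a i))
  rw [dirichletLaw, lintegral_map (by fun_prop) (by fun_prop)]
  have h1 : ∀ᵐ y ∂(Measure.pi fun i => gammaLaw (a i)),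
      ∏ i, ENNReal.ofReal (y (f i) / ∑ k, y k) =
        ∫⁻ u in Set.Ioi (0 : ℝ), ENNReal.ofReal ((Real.Gamma m)⁻¹ * u ^ ((m : ℝ) - 1)) *
          ∏ k, ENNReal.ofReal (y k ^ N k * Real.exp (-(u * y k))) := by
    filter_upwards [hnn] with y hy
    have hs : 0 ≤ ∑ k, y k := Finset.sum_nonneg fun k _ => hy k
    have hprod : ∀ u ∈ Set.Ioi (0 : ℝ),
        ENNReal.ofReal ((Real.Gamma m)⁻¹ * u ^ ((m : ℝ) - 1)) *
          ∏ k, ENNReal.ofReal (y k ^ N k * Real.exp (-(u * y k))) =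
        ENNReal.ofReal ((∏ k, y k ^ N k) * (Real.Gamma m)⁻¹) *
          ENNReal.ofReal (u ^ ((m : ℝ) - 1) * Real.exp (-((∑ k, y k) * u))) := by
      intro u hu
      have hu' : (0 : ℝ) < u := hu
      have := Real.Gamma_pos_of_pos hm'
      have hp : 0 ≤ ∏ k, y k ^ N k := Finset.prod_nonneg fun k _ => pow_nonneg (hy k) _
      rw [← ENNReal.ofReal_prod_of_nonneg fun k _ => mul_nonneg (pow_nonneg (hy k) _)
          (Real.exp_pos _).le, ← ENNReal.ofReal_mul (by positivity),
        ← ENNReal.ofReal_mul (by positivity), Finset.prod_mul_distrib, ← Real.exp_sum,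
        Finset.sum_neg_distrib, ← Finset.mul_sum]
      congr 1
      rw [mul_comm u]
      ring
    rw [setLIntegral_congr_fun measurableSet_Ioi hprod, lintegral_const_mul' _ _ (by simp)]
    have hp : 0 ≤ ∏ k, y k ^ N k := Finset.prod_nonneg fun k _ => pow_nonneg (hy k) _
    -- If all `y k` vanish, division by zero makes the left side `0`. On the right the `u`-integral
    -- is infinite, but its coefficient is `0` because the first letter has positive exponent.
    rcases hs.eq_or_lt with hs0 | hs0
    · have hy0 : ∀ k, y k = 0 := fun k =>
        (Finset.sum_eq_zero_iff_of_nonneg fun k _ => hy k).1 hs0.symm k (Finset.mem_univ k)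
      have hz : ∏ k, y k ^ N k = 0 := by
        refine Finset.prod_eq_zero (Finset.mem_univ (f ⟨0, hm⟩)) ?_
        rw [hy0, zero_pow]
        exact (Finset.card_pos.2 ⟨⟨0, hm⟩, by simp⟩).ne'
      rw [hz, Finset.prod_eq_zero (Finset.mem_univ (⟨0, hm⟩ : Fin m)) (by simp [hy0])]
      simp
    · rw [ENNReal.ofReal_mul hp, mul_assoc, ← inv_pow_eq_lintegral hs0 hm,
        ← ENNReal.ofReal_prod_of_nonneg fun k _ => div_nonneg (hy _) hs,
        ← ENNReal.ofReal_mul hp]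
      congr 1
      rw [Finset.prod_div_distrib, prod_comp_fin f y, Finset.prod_const, Finset.card_univ,
        Fintype.card_fin, div_eq_mul_inv]
  rw [lintegral_congr_ae h1, lintegral_lintegral_swap (by fun_prop)]
  have h2 : ∀ u ∈ Set.Ioi (0 : ℝ),
      ∫⁻ y, ENNReal.ofReal ((Real.Gamma m)⁻¹ * u ^ ((m : ℝ) - 1)) *
          ∏ k, ENNReal.ofReal (y k ^ N k * Real.exp (-(u * y k)))
          ∂(Measure.pi fun i => gammaLaw (a i)) =
        ENNReal.ofReal ((Real.Gamma m)⁻¹ * ∏ k, risingFactorial (a k) (N k)) *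
          ENNReal.ofReal (u ^ ((m : ℝ) - 1) * (1 + u) ^ (-((∑ k, a k) + m))) := by
    intro u hu
    have hu' : (0 : ℝ) < u := hu
    have := Real.Gamma_pos_of_pos hm'
    have hp : 0 ≤ ∏ k, risingFactorial (a k) (N k) :=
      Finset.prod_nonneg fun k _ => risingFactorial_nonneg (ha k) _
    rw [lintegral_const_mul' _ _ (by simp),
      lintegral_prod_eq_prod_lintegral_of_indepFun Finset.univ _
        (iIndepFun_pi (μ := fun i => gammaLaw (a i))
          (X := fun k y => ENNReal.ofReal (y ^ N k * Real.exp (-(u * y)))) fun k => by fun_prop)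
        fun k => by fun_prop]
    have h3 : ∀ k, ∫⁻ y, ENNReal.ofReal (y k ^ N k * Real.exp (-(u * y k)))
        ∂(Measure.pi fun i => gammaLaw (a i)) =
        ENNReal.ofReal (risingFactorial (a k) (N k) * (1 + u) ^ (-(a k + N k))) := by
      intro k
      rw [← lintegral_pow_mul_exp_gammaLaw (ha k) hu'.le,
        ← (measurePreserving_eval (fun i => gammaLaw (a i)) k).lintegral_comp (by fun_prop)]
    rw [Finset.prod_congr rfl fun k _ => h3 k,
      ← ENNReal.ofReal_prod_of_nonneg fun k _ => mul_nonneg (risingFactorial_nonneg (ha k) _)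
        (by positivity), ← ENNReal.ofReal_mul (by positivity),
      ← ENNReal.ofReal_mul (by positivity), Finset.prod_mul_distrib,
      ← Real.rpow_sum_of_pos (by positivity), Finset.sum_neg_distrib, Finset.sum_add_distrib,
      ← Nat.cast_sum, hNsum]
    congr 1
    ring
  have hp : 0 ≤ ∏ k, risingFactorial (a k) (N k) :=
    Finset.prod_nonneg fun k _ => risingFactorial_nonneg (ha k) _
  have hΓ := Real.Gamma_pos_of_pos hm'
  have hΓA := Real.Gamma_pos_of_pos hA
  have hr := risingFactorial_pos hA m
  rw [setLIntegral_congr_fun measurableSet_Ioi h2, lintegral_const_mul' _ _ (by simp),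
    lintegral_rpow_mul_one_add_rpow hm' hA, ← ENNReal.ofReal_mul (by positivity),
    Gamma_add_nat hA, polyaProb]
  congr 1
  field_simp
  rfl

lemma card_filter_cons {κ : Type*} [DecidableEq κ] {m : ℕ} (k₀ k : κ) (f : Fin m → κ) :
    (Finset.univ.filter fun i => (Fin.cons k₀ f : Fin (m + 1) → κ) i = k).card =
      (Finset.univ.filter fun i => f i = k).card + if k₀ = k then 1 else 0 := by
  simp only [Finset.card_filter, Fin.sum_univ_succ, Fin.cons_zero, Fin.cons_succ]
  ring

lemma polyaProb_cons {κ : Type*} [Fintype κ] [DecidableEq κ] (a : κ → ℝ) {m : ℕ} (k₀ : κ)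
    (f : Fin m → κ) :
    polyaProb a (Fin.cons k₀ f : Fin (m + 1) → κ) =
      polyaProb a f * ((a k₀ + (Finset.univ.filter fun i => f i = k₀).card) /
        (∑ k, a k + m)) := by
  have h : ∀ k, risingFactorial (a k)
      (Finset.univ.filter fun i => (Fin.cons k₀ f : Fin (m + 1) → κ) i = k).card =
      risingFactorial (a k) (Finset.univ.filter fun i => f i = k).card *
        if k₀ = k then a k + (Finset.univ.filter fun i => f i = k).card else 1 := by
    intro k
    rw [card_filter_cons]
    split_ifs <;> simp [risingFactorial_succ]
  simp only [polyaProb, h, Finset.prod_mul_distrib, risingFactorial_succ]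
  rw [Finset.prod_ite_eq Finset.univ k₀ fun k =>
    a k + ((Finset.univ.filter fun i => f i = k).card : ℝ)]
  simp only [Finset.mem_univ, if_true]
  rw [mul_div_mul_comm]

/-! ## The Beta-Binomial mass function in closed form -/

/-- The probability that `l` of `c` successive draws from a Pólya urn follow the first draw, in an
urn of total weight `a`. -/
noncomputable def polyaBlockMass (a : ℝ) (c l : ℕ) : ℝ :=
  (c.choose l : ℝ) * (l.factorial : ℝ) * a * risingFactorial a (c - l) / risingFactorial a (c + 1)

lemma polyaBlockMass_nonneg {a : ℝ} (ha : 0 ≤ a) (c l : ℕ) : 0 ≤ polyaBlockMass a c l := by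
  have h1 := risingFactorial_nonneg ha (c - l)
  have h2 := risingFactorial_nonneg ha (c + 1)
  unfold polyaBlockMass
  positivity

lemma polyaBlockMass_of_lt {a : ℝ} {c l : ℕ} (h : c < l) : polyaBlockMass a c l = 0 := by
  simp [polyaBlockMass, Nat.choose_eq_zero_of_lt h]

lemma risingFactorial_one_add_sub {c l : ℕ} (h : l ≤ c) :
    risingFactorial ((c : ℝ) - l + 1) l = c.choose l * l.factorial := by
  obtain ⟨d, rfl⟩ := Nat.exists_eq_add_of_le h
  rw [show ((l + d : ℕ) : ℝ) - l + 1 = d + 1 by push_cast; ring]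
  have h1 : risingFactorial ((d : ℝ) + 1) l = ((d + 1).ascFactorial l : ℝ) := by
    induction l with
    | zero => simp
    | succ l ih =>
      rw [risingFactorial_succ, ih (by omega), Nat.ascFactorial_succ]
      push_cast
      ring
  rw [h1, Nat.ascFactorial_eq_factorial_mul_choose, Nat.add_comm d l]
  push_cast
  ring

lemma polyaBlockMass_eq {a : ℝ} (ha : 0 < a) {c l : ℕ} (h : l ≤ c) :
    polyaBlockMass a c l =
      a * (risingFactorial ((c : ℝ) - l + 1) l / risingFactorial (a + c - l) (l + 1)) := by
  have h1 : risingFactorial a (c + 1) =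
      risingFactorial a (c - l) * risingFactorial (a + c - l) (l + 1) := by
    rw [show c + 1 = (c - l) + (l + 1) by omega, risingFactorial_add]
    congr 2
    rw [Nat.cast_sub h]
    ring
  have h2 := risingFactorial_pos ha (c - l)
  have h3 : 0 < risingFactorial (a + c - l) (l + 1) := by
    apply risingFactorial_pos
    have : (l : ℝ) ≤ c := by exact_mod_cast h
    linarith
  rw [polyaBlockMass, h1, risingFactorial_one_add_sub h]
  field_simp

lemma polyaBlockMass_zero {a : ℝ} (ha : 0 < a) (l : ℕ) :
    polyaBlockMass a 0 l = if l = 0 then 1 else 0 := by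
  rcases Nat.eq_zero_or_pos l with rfl | hl
  · simp [polyaBlockMass, risingFactorial, ha.ne']
  · rw [polyaBlockMass_of_lt hl, if_neg hl.ne']

/-- The recursion of the urn: the next draw joins the block of the first draw with weight `l`. -/
lemma polyaBlockMass_succ {a : ℝ} (ha : 0 < a) (c l : ℕ) :
    (a + (c + 1)) * polyaBlockMass a (c + 1) l =
      l * polyaBlockMass a c (l - 1) + (a + (c - l : ℕ)) * polyaBlockMass a c l := by
  have hr := risingFactorial_pos ha (c + 1)
  have hac : 0 < a + (c + 1) := by positivity
  rcases l with _ | l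
  · simp only [polyaBlockMass, Nat.choose_zero_right, Nat.sub_zero, CharP.cast_eq_zero, zero_mul,
      zero_add]
    rw [risingFactorial_succ a (c + 1), risingFactorial_succ a c]
    have := risingFactorial_pos ha c
    push_cast
    field_simp
  rcases lt_trichotomy c l with h | rfl | h
  · rw [polyaBlockMass_of_lt (by omega), Nat.add_sub_cancel, polyaBlockMass_of_lt h,
      polyaBlockMass_of_lt (by omega)]
    ring
  · rw [polyaBlockMass_of_lt (a := a) (Nat.lt_succ_self c)]
    simp only [polyaBlockMass, Nat.choose_self, Nat.sub_self, Nat.add_sub_cancel]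
    rw [risingFactorial_succ a (c + 1), Nat.factorial_succ]
    push_cast
    field_simp
    ring
  · obtain ⟨d, rfl⟩ := Nat.exists_eq_add_of_lt h
    have hps : ((l + d + 1 + 1).choose (l + 1) : ℝ) =
        (l + d + 1).choose l + (l + d + 1).choose (l + 1) := by
      exact_mod_cast Nat.choose_succ_succ (l + d + 1) l
    simp only [polyaBlockMass, Nat.add_sub_cancel]
    rw [hps, show l + d + 1 + 1 - (l + 1) = d + 1 by omega, show l + d + 1 - l = d + 1 by omega,
      show l + d + 1 - (l + 1) = d by omega, risingFactorial_succ a (l + d + 1 + 1),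
      risingFactorial_succ a d, Nat.factorial_succ]
    push_cast at hac ⊢
    field_simp

lemma integral_betaPDFReal {α β : ℝ} (hα : 0 < α) (hβ : 0 < β) :
    ∫ p, betaPDFReal α β p = 1 := by
  have h := lintegral_betaPDF_eq_one hα hβ
  rw [integral_eq_lintegral_of_nonneg_ae]
  · simpa [betaPDF] using congrArg ENNReal.toReal h
  · refine ae_of_all _ fun p => ?_
    unfold betaPDFReal
    have := beta_pos hα hβ
    split_ifs with hp
    · have h1 : 0 ≤ 1 - p := by linarith [hp.2]
      have h2 := hp.1.le
      simp only [Pi.zero_apply]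
      positivity
    · rfl
  · exact (measurable_betaPDFReal α β).aestronglyMeasurable

/-- Conjugacy: `p ^ l * (1 - p) ^ (c - l)` times the `Beta(1, a)` density is a multiple of the
`Beta(1 + l, a + c - l)` density, which integrates to `1`. -/
lemma betaBinomialMass_one {a : ℝ} (ha : 0 < a) (c l : ℕ) :
    betaBinomialMass c 1 a l = polyaBlockMass a c l := by
  rcases lt_or_ge c l with h | h
  · rw [polyaBlockMass_of_lt h]
    simp [betaBinomialMass, Nat.choose_eq_zero_of_lt h]
  have hl : (0 : ℝ) < 1 + l := by positivity
  have hc : 0 < a + (c - l : ℕ) := by positivity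
  have hb := beta_pos hl hc
  have hb1 := beta_pos one_pos ha
  have hnn : ∀ p, 0 ≤ betaPDFReal 1 a p := by
    intro p
    by_cases hp : 0 < p ∧ p < 1
    · exact (betaPDFReal_pos hp.1 hp.2 one_pos ha).le
    · simp [betaPDFReal, hp]
  have hint : betaBinomialMass c 1 a l = ∫ p, (c.choose l * beta (1 + l) (a + (c - l : ℕ)) /
      beta 1 a) * betaPDFReal (1 + l) (a + (c - l : ℕ)) p := by
    unfold betaBinomialMass betaMeasure
    rw [integral_withDensity_eq_integral_toReal_smul (f := betaPDF 1 a)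
      (measurable_betaPDFReal 1 a).ennreal_ofReal (by simp [betaPDF])]
    refine integral_congr_ae (ae_of_all _ fun p => ?_)
    simp only [betaPDF, smul_eq_mul, ENNReal.toReal_ofReal (hnn p)]
    by_cases hp : 0 < p ∧ p < 1
    · have hq : 0 < 1 - p := by linarith [hp.2]
      simp only [betaPDFReal, if_pos hp]
      rw [show (1 : ℝ) + l - 1 = (1 - 1) + l by ring, Real.rpow_add_natCast hp.1.ne',
        show a + ((c - l : ℕ) : ℝ) - 1 = (a - 1) + ((c - l : ℕ) : ℝ) by ring,
        Real.rpow_add_natCast hq.ne']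
      field_simp
    · simp [betaPDFReal, hp]
  rw [hint, integral_const_mul, integral_betaPDFReal hl hc, mul_one, polyaBlockMass, beta, beta]
  have e1 : (1 : ℝ) + l + (a + (c - l : ℕ)) = a + (c + 1 : ℕ) := by
    rw [Nat.cast_sub h]; push_cast; ring
  rw [e1, Gamma_add_nat ha, Gamma_add_nat ha, add_comm (1 : ℝ) a, add_comm (1 : ℝ) l,
    Real.Gamma_nat_eq_factorial, Real.Gamma_add_one ha.ne', Real.Gamma_one]
  have := Real.Gamma_pos_of_pos ha
  have := risingFactorial_pos ha (c + 1)
  field_simp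

/-! ## The Poisson-Kingman formula for the Gamma completely random measure -/

/-- This is the Frullani integral of `exp (-s)` between the scales `1` and `1 + u`. -/
lemma levyExponent_gammaLevyDensity {u : ℝ} (hu : 0 < u) :
    levyExponent gammaLevyDensity u = Real.log (1 + u) := by
  -- The inequality `1 - exp (-(u * s)) ≤ u * s` cancels the singularity `s⁻¹` at the origin.
  have hbound : ∀ s ∈ Set.Ioi (0 : ℝ),
      ‖s⁻¹ • (Real.exp (-(1 * s)) - Real.exp (-((1 + u) * s)))‖ ≤ u * Real.exp (-s) := by
    intro s hs
    have hs' : (0 : ℝ) < s := hs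
    have h1 : Real.exp (-((1 + u) * s)) = Real.exp (-s) * Real.exp (-(u * s)) := by
      rw [← Real.exp_add]
      ring_nf
    have h2 := Real.add_one_le_exp (-(u * s))
    have h3 : Real.exp (-(u * s)) ≤ 1 := Real.exp_le_one_iff.2 (by nlinarith)
    have h4 := Real.exp_pos (-s)
    rw [h1, one_mul, smul_eq_mul, Real.norm_eq_abs, abs_of_nonneg]
    · rw [inv_mul_le_iff₀ hs']
      nlinarith
    · refine mul_nonneg (inv_nonneg.2 hs'.le) ?_
      nlinarith
  have hint : IntegrableOn (fun s : ℝ => s⁻¹ • (Real.exp (-(1 * s)) - Real.exp (-((1 + u) * s))))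
      (Set.Ioi 0) := by
    refine Integrable.mono' ((integrableOn_exp_neg_Ioi 0).const_mul u) (by fun_prop) ?_
    filter_upwards [ae_restrict_mem measurableSet_Ioi] with s hs using hbound s hs
  have hcont : Continuous fun s : ℝ => Real.exp (-s) := by fun_prop
  have hL : Filter.Tendsto (fun s : ℝ => Real.exp (-s)) (nhdsWithin 0 (Set.Ioi 0)) (nhds 1) := by
    have := (hcont.tendsto 0).mono_left (nhdsWithin_le_nhds (s := Set.Ioi (0 : ℝ)))
    simpa using this
  have h := Frullani.integral_Ioi_eq (f := fun s : ℝ => Real.exp (-s))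
    (hcont.locallyIntegrable.locallyIntegrableOn _) one_pos (by positivity : 0 < 1 + u) hL
    (Real.tendsto_exp_neg_atTop_nhds_zero) hint
  rw [div_one, sub_zero, smul_eq_mul, mul_one] at h
  rw [← h, levyExponent]
  refine setIntegral_congr_fun measurableSet_Ioi fun s hs => ?_
  have h1 : Real.exp (-((1 + u) * s)) = Real.exp (-s) * Real.exp (-(u * s)) := by
    rw [← Real.exp_add]
    ring_nf
  simp only [gammaLevyDensity, h1, one_mul, smul_eq_mul]
  ring

/-- Near `u` the function `exp (-a ψ)` is `(1 + z) ^ (-a)`; the sign `(-1) ^ m` turns the falling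
factorial of `-a` into the rising factorial of `a`. -/
lemma levyPhi_gammaLevyDensity {a u : ℝ} (hu : 0 < u) (m : ℕ) :
    levyPhi gammaLevyDensity a m u = risingFactorial a m * (1 + u) ^ (-a - m) := by
  have hev : (fun z => Real.exp (-(a * levyExponent gammaLevyDensity z))) =ᶠ[nhds u]
      fun z => (fun x : ℝ => x ^ (-a)) (1 + z) := by
    filter_upwards [isOpen_Ioi.mem_nhds (show u ∈ Set.Ioi (0 : ℝ) from hu)] with z hz
    have hz' : (0 : ℝ) < z := hz
    rw [levyExponent_gammaLevyDensity hz', Real.rpow_def_of_pos (by positivity)]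
    ring_nf
  have hcomp := congrFun (iteratedDeriv_comp_const_add m (fun x : ℝ => x ^ (-a)) 1) u
  rw [levyPhi, hev.iteratedDeriv_eq, hcomp, iteratedDeriv_eq_iterate, Real.iter_deriv_rpow_const,
    ← mul_assoc]
  congr 1
  rw [descPochhammer_eval_eq_prod_range, risingFactorial]
  have h1 := Finset.prod_const (s := Finset.range m) (-1 : ℝ)
  rw [Finset.card_range] at h1
  rw [← h1, ← Finset.prod_mul_distrib]
  exact Finset.prod_congr rfl fun i _ => by ring

lemma levyMoment_gammaLevyDensity {u : ℝ} (hu : 0 < u) (l : ℕ) :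
    levyMoment gammaLevyDensity u (l + 1) = l.factorial * (1 + u) ^ (-(l : ℝ) - 1) := by
  have h := Real.integral_rpow_mul_exp_neg_mul_Ioi (a := (l : ℝ) + 1) (r := 1 + u)
    (by positivity) (by positivity)
  rw [Real.Gamma_nat_eq_factorial] at h
  rw [mul_comm, show -(l : ℝ) - 1 = -((l : ℝ) + 1) by ring, Real.rpow_neg (by positivity),
    ← Real.inv_rpow (by positivity), ← one_div, ← h, levyMoment]
  refine setIntegral_congr_fun measurableSet_Ioi fun s hs => ?_
  have hs' : (0 : ℝ) < s := hs
  have h1 : Real.exp (-((1 + u) * s)) = Real.exp (-s) * Real.exp (-(u * s)) := by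
    rw [← Real.exp_add]
    ring_nf
  simp only [gammaLevyDensity, h1, add_sub_cancel_right, Real.rpow_natCast, pow_succ]
  field_simp

lemma integral_rpow_mul_one_add_rpow_pos {θ : ℝ} (hθ : 0 < θ) (n : ℕ) :
    0 < ∫ u in Set.Ioi (0 : ℝ), u ^ (n : ℝ) * (1 + u) ^ (-(θ + (n + 1))) := by
  have h := lintegral_rpow_mul_one_add_rpow (p := (n : ℝ) + 1) (A := θ) (by positivity) hθ
  rw [add_sub_cancel_right] at h
  rw [integral_eq_lintegral_of_nonneg_ae, h, ENNReal.toReal_ofReal]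
  · have := Real.Gamma_pos_of_pos hθ
    have : 0 < Real.Gamma ((n : ℝ) + 1) := Real.Gamma_pos_of_pos (by positivity)
    have : 0 < Real.Gamma (θ + ((n : ℝ) + 1)) := Real.Gamma_pos_of_pos (by positivity)
    positivity
  · have := Real.Gamma_pos_of_pos hθ
    have : 0 < Real.Gamma ((n : ℝ) + 1) := Real.Gamma_pos_of_pos (by positivity)
    have : 0 < Real.Gamma (θ + ((n : ℝ) + 1)) := Real.Gamma_pos_of_pos (by positivity)
    positivity
  · filter_upwards [ae_restrict_mem measurableSet_Ioi] with u hu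
    have : (0 : ℝ) < u := hu
    simp only [Pi.zero_apply]
    positivity
  · exact (by fun_prop : Measurable fun u : ℝ =>
      u ^ (n : ℝ) * (1 + u) ^ (-(θ + (n + 1)))).aestronglyMeasurable

lemma prod_levyPhi_gammaLevyDensity {ι : Type*} (s : Finset ι) {a u : ℝ} (hu : 0 < u)
    (c : ι → ℕ) :
    ∏ k ∈ s, levyPhi gammaLevyDensity a (c k) u =
      (∏ k ∈ s, risingFactorial a (c k)) * (1 + u) ^ (∑ k ∈ s, (-a - c k)) := by
  rw [Finset.prod_congr rfl fun k _ => levyPhi_gammaLevyDensity hu (c k),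
    Finset.prod_mul_distrib, Real.rpow_sum_of_pos (by positivity)]

/-- In numerator and denominator alike the exponents of `1 + u` add up to `-(θ + n + 1)`. Both
integrals are multiples of the same positive number, which cancels. -/
lemma pkPosterior_gammaLevyDensity {θ : ℝ} (hθ : 0 < θ) {n J : ℕ} {c : Fin J → ℕ}
    (hc : ∑ k, c k = n) (j : Fin J) {l : ℕ} (hl : l ≤ c j) :
    pkPosterior θ gammaLevyDensity 0 0 n c j l = polyaBlockMass (θ / J) (c j) l := by
  have hJ : (0 : ℝ) < J := by exact_mod_cast j.pos
  have ha : 0 < θ / J := by positivity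
  set a := θ / J with ha_def
  have hsum : ∑ k ∈ Finset.univ.erase j, (-a - (c k : ℝ)) = -θ - n + a + c j := by
    have h1 : ∑ k, (-a - (c k : ℝ)) = -θ - n := by
      rw [Finset.sum_sub_distrib, ← hc]
      simp only [Finset.sum_const, Finset.card_univ, Fintype.card_fin, nsmul_eq_mul,
        Nat.cast_sum, ha_def]
      field_simp
    rw [← Finset.add_sum_erase _ _ (Finset.mem_univ j)] at h1
    linarith
  set R := ∏ k ∈ Finset.univ.erase j, risingFactorial a (c k) with hR
  have hRpos : 0 < R := Finset.prod_pos fun k _ => risingFactorial_pos ha _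
  have hnum : ∀ u ∈ Set.Ioi (0 : ℝ), u ^ ((n : ℝ) + 0) *
      levyPhi gammaLevyDensity a (c j - l) (u + 0) *
        (∏ k ∈ Finset.univ.erase j, levyPhi gammaLevyDensity a (c k) (u + 0)) *
          levyMoment gammaLevyDensity (u + 0) (l + 1) =
      (risingFactorial a (c j - l) * R * l.factorial) *
        (u ^ (n : ℝ) * (1 + u) ^ (-(θ + (n + 1)))) := by
    intro u hu
    have hu' : (0 : ℝ) < u := hu
    have h1u : 0 < 1 + u := by positivity
    have he : (1 + u) ^ (-(θ + ((n : ℝ) + 1))) = (1 + u) ^ (-a - ((c j - l : ℕ) : ℝ)) *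
        (1 + u) ^ (-θ - n + a + c j) * (1 + u) ^ (-(l : ℝ) - 1) := by
      rw [← Real.rpow_add h1u, ← Real.rpow_add h1u, Nat.cast_sub hl]
      ring_nf
    rw [add_zero, add_zero, levyPhi_gammaLevyDensity hu', levyMoment_gammaLevyDensity hu',
      prod_levyPhi_gammaLevyDensity _ hu', hsum, ← hR, he]
    generalize (1 + u) ^ (-θ - n + a + c j) = x
    ring
  have hden : ∀ u ∈ Set.Ioi (0 : ℝ), u ^ ((n : ℝ) + 0) *
      levyPhi gammaLevyDensity a (c j + 1) (u + 0) *
        (∏ k ∈ Finset.univ.erase j, levyPhi gammaLevyDensity a (c k) (u + 0)) =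
      (risingFactorial a (c j + 1) * R) *
        (u ^ (n : ℝ) * (1 + u) ^ (-(θ + (n + 1)))) := by
    intro u hu
    have hu' : (0 : ℝ) < u := hu
    have h1u : 0 < 1 + u := by positivity
    have he : (1 + u) ^ (-(θ + ((n : ℝ) + 1))) = (1 + u) ^ (-a - ((c j + 1 : ℕ) : ℝ)) *
        (1 + u) ^ (-θ - n + a + c j) := by
      rw [← Real.rpow_add h1u]
      push_cast
      ring_nf
    rw [add_zero, add_zero, levyPhi_gammaLevyDensity hu', prod_levyPhi_gammaLevyDensity _ hu',
      hsum, ← hR, he]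
    generalize (1 + u) ^ (-θ - n + a + c j) = x
    ring
  have hI := integral_rpow_mul_one_add_rpow_pos hθ n
  have hr := risingFactorial_pos ha (c j + 1)
  rw [pkPosterior, setIntegral_congr_fun measurableSet_Ioi hnum,
    setIntegral_congr_fun measurableSet_Ioi hden, integral_const_mul, integral_const_mul,
    polyaBlockMass, ← ha_def]
  field_simp

/-! ## The Hoppe urn -/

/-- One step of the Hoppe urn: the new draw gets the fresh label `m` with probability
`θ / (θ + m)`, and otherwise copies the label of a uniformly chosen earlier draw. -/
noncomputable def hoppeStep (θ : ℝ) (m : ℕ) (r : Fin m → ℕ) : Measure (Fin (m + 1) → ℕ) :=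
  ENNReal.ofReal (θ / (θ + m)) • Measure.dirac (Fin.cons m r) +
    ENNReal.ofReal (1 / (θ + m)) • ∑ i, Measure.dirac (Fin.cons (r i) r)

/-- The law of the labels of `m` draws from the Hoppe urn. The most recent draw comes first. -/
noncomputable def hoppeLaw (θ : ℝ) : (m : ℕ) → Measure (Fin m → ℕ)
  | 0 => Measure.dirac fun i => i.elim0
  | m + 1 => (hoppeLaw θ m).bind (hoppeStep θ m)

lemma lintegral_hoppeLaw_zero (θ : ℝ) (F : (Fin 0 → ℕ) → ℝ≥0∞) :
    ∫⁻ r, F r ∂(hoppeLaw θ 0) = F fun i => i.elim0 := by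
  rw [hoppeLaw, lintegral_dirac]

lemma lintegral_hoppeLaw_succ (θ : ℝ) (m : ℕ) (F : (Fin (m + 1) → ℕ) → ℝ≥0∞) :
    ∫⁻ r, F r ∂(hoppeLaw θ (m + 1)) = ∫⁻ r, (ENNReal.ofReal (θ / (θ + m)) * F (Fin.cons m r) +
      ENNReal.ofReal (1 / (θ + m)) * ∑ i, F (Fin.cons (r i) r)) ∂(hoppeLaw θ m) := by
  rw [hoppeLaw, Measure.lintegral_bind (Measurable.of_discrete.aemeasurable)
    (Measurable.of_discrete.aemeasurable)]
  simp [hoppeStep, lintegral_add_measure, lintegral_smul_measure]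

/-- Guarantees that the label `m` introduced at step `m` is indeed fresh. -/
lemma ae_hoppeLaw_lt (θ : ℝ) (m : ℕ) : ∀ᵐ r ∂(hoppeLaw θ m), ∀ i, r i < m := by
  induction m with
  | zero => exact ae_of_all _ fun r i => i.elim0
  | succ m ih =>
    rw [ae_iff, ← lintegral_indicator_one (MeasurableSet.of_discrete), lintegral_hoppeLaw_succ,
      lintegral_eq_zero_iff Measurable.of_discrete]
    filter_upwards [ih] with r hr
    have h1 : (Fin.cons m r : Fin (m + 1) → ℕ) ∉ {s : Fin (m + 1) → ℕ | ¬ ∀ i, s i < m + 1} := by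
      simp only [Set.mem_ofPred_eq, not_not]
      refine Fin.cases (by simp) fun i => ?_
      simpa using (hr i).trans (Nat.lt_succ_self m)
    have h2 : ∀ i, (Fin.cons (r i) r : Fin (m + 1) → ℕ) ∉
        {s : Fin (m + 1) → ℕ | ¬ ∀ i, s i < m + 1} := by
      intro i
      simp only [Set.mem_ofPred_eq, not_not]
      refine Fin.cases ?_ fun i' => ?_
      · simpa using (hr i).trans (Nat.lt_succ_self m)
      · simpa using (hr i').trans (Nat.lt_succ_self m)
    rw [Set.indicator_of_notMem h1, Finset.sum_eq_zero fun i _ => Set.indicator_of_notMem (h2 i) _]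
    simp

lemma polyaProb_nonneg {κ : Type*} [Fintype κ] [DecidableEq κ] {m : ℕ} {a : κ → ℝ} (ha : ∀ k, 0 ≤ a k) (f : Fin m → κ) : 0 ≤ polyaProb a f :=
  div_nonneg (Finset.prod_nonneg fun k _ => risingFactorial_nonneg (ha k) _)
    (risingFactorial_nonneg (Finset.sum_nonneg fun k _ => ha k) _)

lemma polyaProb_pos {κ : Type*} [Fintype κ] [DecidableEq κ] {m : ℕ} {a : κ → ℝ} (ha : ∀ k, 0 < a k) (hA : 0 < ∑ k, a k) (f : Fin m → κ) :
    0 < polyaProb a f :=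
  div_pos (Finset.prod_pos fun k _ => risingFactorial_pos (ha k) _) (risingFactorial_pos hA _)

/-! ## Box probabilities for labelled samples -/

section Box

variable {S κ : Type*} [MeasurableSpace S]

/-- The probability that `y (r i) ∈ B (f i)` for all `i`, when the `y l` are i.i.d. with
law `ν`. -/
noncomputable def labelledBoxProb (ν : Measure S) (B : κ → Set S) {m : ℕ} (r : Fin m → ℕ)
    (f : Fin m → κ) : ℝ≥0∞ :=
  Measure.infinitePi (fun _ : ℕ => ν) {y | ∀ i, y (r i) ∈ B (f i)}

variable {ν : Measure S} {B : κ → Set S} {m : ℕ} {r : Fin m → ℕ} {f : Fin m → κ}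

lemma labelledBoxProb_eq_zero (hBd : Pairwise fun k k' => Disjoint (B k) (B k')) {i i' : Fin m}
    (hr : r i = r i') (hf : f i ≠ f i') : labelledBoxProb ν B r f = 0 := by
  rw [labelledBoxProb]
  convert measure_empty (μ := Measure.infinitePi fun _ : ℕ => ν)
  ext y
  simp only [Set.mem_ofPred_eq, Set.mem_empty_iff_false, iff_false]
  intro h
  exact Set.disjoint_left.1 (hBd hf) (h i) (hr ▸ h i')

lemma labelledBoxProb_cons_old [DecidableEq κ]
    (hBd : Pairwise fun k k' => Disjoint (B k) (B k')) (i : Fin m) (k : κ) :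
    labelledBoxProb ν B (Fin.cons (r i) r : Fin (m + 1) → ℕ) (Fin.cons k f : Fin (m + 1) → κ) =
      if f i = k then labelledBoxProb ν B r f else 0 := by
  split_ifs with h
  · subst h
    simp only [labelledBoxProb]
    congr 1
    ext y
    simp only [Set.mem_ofPred_eq, Fin.forall_fin_succ, Fin.cons_zero, Fin.cons_succ]
    exact ⟨fun h => h.2, fun h => ⟨h i, h⟩⟩
  · exact labelledBoxProb_eq_zero hBd (i := 0) (i' := i.succ) (by simp) (by simpa using Ne.symm h)

variable [IsProbabilityMeasure ν]

/-- Conditions on the same label constrain the same coordinate, and distinct coordinates are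
independent. -/
lemma labelledBoxProb_eq_prod (hB : ∀ k, MeasurableSet (B k)) (N : ℕ) (hr : ∀ i, r i < N) :
    labelledBoxProb ν B r f =
      ∏ l ∈ Finset.range N, ν (⋂ i, ⋂ (_ : r i = l), B (f i)) := by
  rw [labelledBoxProb, ← Measure.infinitePi_pi (fun _ : ℕ => ν)]
  · congr 1
    ext y
    simp only [Set.mem_ofPred_eq, Set.mem_pi, Finset.coe_range, Set.mem_Iio, Set.mem_iInter]
    exact ⟨fun h l _ i hi => hi ▸ h i, fun h i => h (r i) (hr i) i rfl⟩
  · exact fun l _ => MeasurableSet.iInter fun i => MeasurableSet.iInter fun _ => hB _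

lemma labelledBoxProb_cons_new (hB : ∀ k, MeasurableSet (B k)) (hr : ∀ i, r i < m) (k : κ) :
    labelledBoxProb ν B (Fin.cons m r : Fin (m + 1) → ℕ) (Fin.cons k f : Fin (m + 1) → κ) =
      ν (B k) * labelledBoxProb ν B r f := by
  have hr' : ∀ i, (Fin.cons m r : Fin (m + 1) → ℕ) i < m + 1 :=
    Fin.cases (by simp) fun i => by simpa using (hr i).trans (Nat.lt_succ_self m)
  rw [labelledBoxProb_eq_prod hB _ hr', labelledBoxProb_eq_prod hB _ hr, Finset.prod_range_succ,
    mul_comm]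
  congr 1
  · congr 1
    ext x
    simp only [Set.mem_iInter, Fin.forall_fin_succ, Fin.cons_zero, Fin.cons_succ]
    exact ⟨fun h => h.1 trivial, fun h => ⟨fun _ => h, fun i hi => absurd hi (hr i).ne⟩⟩
  · refine Finset.prod_congr rfl fun l hl => ?_
    congr 1
    ext x
    simp only [Set.mem_iInter, Fin.forall_fin_succ, Fin.cons_zero, Fin.cons_succ]
    exact ⟨fun h => h.2, fun h => ⟨fun hl' => absurd hl' (Finset.mem_range.1 hl).ne', h⟩⟩

variable [Fintype κ]

lemma sum_mul_real_eq (hB : ∀ k, MeasurableSet (B k))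
    (hBd : Pairwise fun k k' => Disjoint (B k) (B k')) (hBu : ⋃ k, B k = Set.univ) (θ : ℝ) :
    ∑ k, θ * ν.real (B k) = θ := by
  have h := measureReal_iUnion_fintype (μ := ν) hBd hB
  rw [hBu, probReal_univ] at h
  rw [← Finset.mul_sum, ← h, mul_one]

variable [DecidableEq κ]

/-- A fresh draw enters box `k` with probability `ν (B k)`, and a copy does so when its source lies
there. One urn step thus multiplies the box probability by `(θ ν (B k) + N k) / (θ + m)`, with `N k`
the current count of `k`; this is the factor in `polyaProb_cons`. -/
theorem lintegral_labelledBoxProb_hoppeLaw {θ : ℝ} (hθ : 0 < θ) (hB : ∀ k, MeasurableSet (B k))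
    (hBd : Pairwise fun k k' => Disjoint (B k) (B k')) (hBu : ⋃ k, B k = Set.univ)
    (f : Fin m → κ) :
    ∫⁻ r, labelledBoxProb ν B r f ∂(hoppeLaw θ m) =
      ENNReal.ofReal (polyaProb (fun k => θ * ν.real (B k)) f) := by
  induction m with
  | zero =>
    rw [lintegral_hoppeLaw_zero]
    simp [labelledBoxProb, polyaProb]
  | succ m ih =>
    obtain ⟨k, f, rfl⟩ : ∃ k g, f = Fin.cons k g := ⟨f 0, Fin.tail f, (Fin.cons_self_tail f).symm⟩
    have hZ := polyaProb_nonneg (a := fun k => θ * ν.real (B k)) (fun k => by positivity) f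
    have hstep : ∀ᵐ r ∂(hoppeLaw θ m),
        ENNReal.ofReal (θ / (θ + m)) * labelledBoxProb ν B (Fin.cons m r : Fin (m + 1) → ℕ)
            (Fin.cons k f : Fin (m + 1) → κ) +
          ENNReal.ofReal (1 / (θ + m)) * ∑ i, labelledBoxProb ν B
            (Fin.cons (r i) r : Fin (m + 1) → ℕ) (Fin.cons k f : Fin (m + 1) → κ) =
        (ENNReal.ofReal (θ / (θ + m)) * ν (B k) + ENNReal.ofReal (1 / (θ + m)) *
          ((Finset.univ.filter fun i => f i = k).card : ℝ≥0∞)) * labelledBoxProb ν B r f := by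
      filter_upwards [ae_hoppeLaw_lt θ m] with r hr
      simp only [labelledBoxProb_cons_new hB hr, labelledBoxProb_cons_old hBd]
      rw [← Finset.sum_filter, Finset.sum_const, nsmul_eq_mul]
      ring
    rw [lintegral_hoppeLaw_succ, lintegral_congr_ae hstep,
      lintegral_const_mul _ Measurable.of_discrete, ih, polyaProb_cons,
      sum_mul_real_eq hB hBd hBu, ← ofReal_measureReal (measure_ne_top ν (B k)),
      ← ENNReal.ofReal_natCast, ← ENNReal.ofReal_mul (by positivity),
      ← ENNReal.ofReal_mul (by positivity), ← ENNReal.ofReal_add (by positivity) (by positivity),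
      ← ENNReal.ofReal_mul (by positivity)]
    congr 1
    field_simp

end Box

/-! ## The multiplicity of the last entry -/

/-- The number of earlier entries of the tuple `x` that are equal to its last entry. -/
noncomputable def lastMultiplicity {α : Type*} [DecidableEq α] {m : ℕ} (x : Fin (m + 1) → α) : ℕ :=
  (Finset.univ.filter fun i : Fin m => x i.castSucc = x (Fin.last m)).card

lemma lastMultiplicity_add_one {α : Type*} [DecidableEq α] {m : ℕ} (x : Fin (m + 1) → α) :
    lastMultiplicity x + 1 = (Finset.univ.filter fun i => x i = x (Fin.last m)).card := by
  simp only [lastMultiplicity, Finset.card_filter, Fin.sum_univ_castSucc, if_true]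

/-- New draws are prepended, so the last entry is the first draw of the urn and stays fixed along
the induction. -/
lemma lastMultiplicity_cons {α : Type*} [DecidableEq α] {m : ℕ} (k : α) (x : Fin (m + 1) → α) :
    lastMultiplicity (Fin.cons k x : Fin (m + 2) → α) =
      lastMultiplicity x + if k = x (Fin.last m) then 1 else 0 := by
  simp only [lastMultiplicity, Finset.card_filter, Fin.sum_univ_succ, ← Fin.succ_last,
    Fin.cons_succ, Fin.castSucc_zero, Fin.cons_zero, ← Fin.succ_castSucc]
  ring

lemma lastMultiplicity_comp {α β : Type*} [DecidableEq α] [DecidableEq β] {m : ℕ} {g : α → β} (hg : Function.Injective g)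
    (x : Fin (m + 1) → α) : lastMultiplicity (fun i => g (x i)) = lastMultiplicity x := by
  simp [lastMultiplicity, hg.eq_iff]

/-! ### Joint law of the boxes and of the block of the last entry -/

section Pattern

variable {S κ : Type*} [MeasurableSpace S] {ν : Measure S} {B : κ → Set S} {m : ℕ}
  [DecidableEq κ]

lemma sum_ite_and_const {ι : Type*} [Fintype ι] (p : ι → Prop) [DecidablePred p] (Q : Prop)
    [Decidable Q] (b : ℝ≥0∞) :
    ∑ i, (if p i ∧ Q then b else 0) =
      ((Finset.univ.filter p).card : ℝ≥0∞) * if Q then b else 0 := by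
  by_cases hQ : Q
  · simp [hQ, ← Finset.sum_filter]
  · simp [hQ]

/-- A copy of the last label must land in the box of the last entry and enlarges its block, from `l
- 1` to `l`. Every other copy keeps the block; in that box its possible sources are the entries
outside the block. -/
lemma sum_labelledBoxProb_cons_old (hBd : Pairwise fun k k' => Disjoint (B k) (B k'))
    (r : Fin (m + 1) → ℕ) (f : Fin (m + 1) → κ) (k : κ) (l : ℕ) :
    ∑ i, (if lastMultiplicity (Fin.cons (r i) r : Fin (m + 2) → ℕ) = l then
      labelledBoxProb ν B (Fin.cons (r i) r : Fin (m + 2) → ℕ) (Fin.cons k f : Fin (m + 2) → κ)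
        else 0) =
      if k = f (Fin.last m) then
        l * (if lastMultiplicity r = l - 1 then labelledBoxProb ν B r f else 0) +
          ((lastMultiplicity f - l : ℕ) : ℝ≥0∞) *
            (if lastMultiplicity r = l then labelledBoxProb ν B r f else 0)
      else ((Finset.univ.filter fun i => f i = k).card : ℝ≥0∞) *
        (if lastMultiplicity r = l then labelledBoxProb ν B r f else 0) := by
  simp only [labelledBoxProb_cons_old hBd, lastMultiplicity_cons]
  set b := labelledBoxProb ν B r f with hb
  by_cases hb0 : b = 0
  · simp [hb0]
  have hcons : ∀ i, r i = r (Fin.last m) → f i = f (Fin.last m) := by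
    intro i hi
    by_contra hne
    exact hb0 (labelledBoxProb_eq_zero hBd hi hne)
  have hterm : ∀ i, (if lastMultiplicity r + (if r i = r (Fin.last m) then 1 else 0) = l then
      (if f i = k then b else 0) else 0) =
      (if r i = r (Fin.last m) ∧ (k = f (Fin.last m) ∧ lastMultiplicity r + 1 = l) then b
        else 0) +
      (if (r i ≠ r (Fin.last m) ∧ f i = k) ∧ lastMultiplicity r = l then b else 0) := by
    intro i
    by_cases h1 : r i = r (Fin.last m)
    · have h2 := hcons i h1
      by_cases h3 : k = f (Fin.last m)
      · simp [h1, h2, h3]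
      · simp [h1, h2, h3, Ne.symm h3]
    · by_cases h4 : f i = k <;> simp [h1, h4]
  rw [Finset.sum_congr rfl fun i _ => hterm i, Finset.sum_add_distrib,
    sum_ite_and_const (fun i => r i = r (Fin.last m)),
    sum_ite_and_const (fun i => r i ≠ r (Fin.last m) ∧ f i = k), ← lastMultiplicity_add_one]
  have hsub : (Finset.univ.filter fun i => r i = r (Fin.last m)) ⊆
      Finset.univ.filter fun i => f i = f (Fin.last m) := by
    intro i hi
    simpa using hcons i (by simpa using hi)
  by_cases hk : k = f (Fin.last m)
  · simp only [hk, true_and, if_true]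
    have hcard : (Finset.univ.filter fun i => r i ≠ r (Fin.last m) ∧ f i = f (Fin.last m)).card =
        lastMultiplicity f - lastMultiplicity r := by
      have h1 : (Finset.univ.filter fun i => r i ≠ r (Fin.last m) ∧ f i = f (Fin.last m)) =
          (Finset.univ.filter fun i => f i = f (Fin.last m)) \
            Finset.univ.filter fun i => r i = r (Fin.last m) := by
        ext i
        simp [and_comm]
      rw [h1, Finset.card_sdiff_of_subset hsub, ← lastMultiplicity_add_one,
        ← lastMultiplicity_add_one]
      omega
    rw [hcard]
    congr 1
    -- For `l = 0` the truncated `l - 1` is harmless, as its coefficient is `l`.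
    · rcases l with _ | l
      · simp
      · by_cases h : lastMultiplicity r = l
        · simp [h]
        · simp [h]
    · by_cases h : lastMultiplicity r = l
      · simp [h]
      · simp [h]
  · simp only [hk, false_and, if_false, mul_zero, zero_add]
    congr 3
    ext i
    simp only [Finset.mem_filter, Finset.mem_univ, true_and, and_iff_right_iff_imp]
    intro hi hr
    exact hk (hi ▸ hcons i hr)

/-- Draws outside the box of the last entry only rescale the probability, by the factor of
`polyaProb_cons`. Draws inside it also raise `lastMultiplicity f` by one, and there the two ways of
reaching `l` combine by `polyaBlockMass_succ`. -/
theorem lintegral_lastMultiplicity_hoppeLaw [IsProbabilityMeasure ν] [Fintype κ] {θ : ℝ} (hθ : 0 < θ) (hB : ∀ k, MeasurableSet (B k))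
    (hBd : Pairwise fun k k' => Disjoint (B k) (B k')) (hBu : ⋃ k, B k = Set.univ)
    (f : Fin (m + 1) → κ) (hf : 0 < ν.real (B (f (Fin.last m)))) (l : ℕ) :
    ∫⁻ r, (if lastMultiplicity r = l then labelledBoxProb ν B r f else 0) ∂(hoppeLaw θ (m + 1)) =
      ENNReal.ofReal (polyaBlockMass (θ * ν.real (B (f (Fin.last m)))) (lastMultiplicity f) l *
        polyaProb (fun k => θ * ν.real (B k)) f) := by
  induction m generalizing l with
  | zero =>
    have h0 : ∀ x : Fin 1 → ℕ, lastMultiplicity x = 0 := fun x => by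
      simp [lastMultiplicity]
    have h1 := lintegral_labelledBoxProb_hoppeLaw (ν := ν) hθ hB hBd hBu f
    have h2 : lastMultiplicity f = 0 := by simp [lastMultiplicity]
    rw [h2, polyaBlockMass_zero (by positivity)]
    simp only [h0]
    by_cases hl : l = 0
    · simp [hl, h1]
    · simp [hl, Ne.symm hl]
  | succ m ih =>
    obtain ⟨k, f, rfl⟩ : ∃ k g, f = Fin.cons k g := ⟨f 0, Fin.tail f, (Fin.cons_self_tail f).symm⟩
    have hlast : (Fin.cons k f : Fin (m + 2) → κ) (Fin.last (m + 1)) = f (Fin.last m) := by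
      rw [← Fin.succ_last, Fin.cons_succ]
    rw [hlast] at hf ⊢
    have ih := ih f hf
    set a : ℝ := θ * ν.real (B (f (Fin.last m))) with ha_def
    have ha : 0 < a := by positivity
    have hZ := polyaProb_nonneg (a := fun k => θ * ν.real (B k)) (fun k => by positivity) f
    set Z := polyaProb (fun k => θ * ν.real (B k)) f with hZdef
    have hg := fun c l => polyaBlockMass_nonneg ha.le c l
    have hstep : ∀ᵐ r ∂(hoppeLaw θ (m + 1)),
        ENNReal.ofReal (θ / (θ + (m + 1 : ℕ))) *
          (if lastMultiplicity (Fin.cons (m + 1) r : Fin (m + 2) → ℕ) = l then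
            labelledBoxProb ν B (Fin.cons (m + 1) r : Fin (m + 2) → ℕ)
              (Fin.cons k f : Fin (m + 2) → κ) else 0) =
        ENNReal.ofReal (θ / (θ + (m + 1 : ℕ))) * ν (B k) *
          (if lastMultiplicity r = l then labelledBoxProb ν B r f else 0) := by
      filter_upwards [ae_hoppeLaw_lt θ (m + 1)] with r hr
      rw [labelledBoxProb_cons_new hB hr, lastMultiplicity_cons, if_neg (hr _).ne', add_zero]
      split_ifs <;> simp [mul_assoc]
    rw [lintegral_hoppeLaw_succ, lintegral_add_left Measurable.of_discrete,
      lintegral_congr_ae hstep, lintegral_const_mul _ Measurable.of_discrete,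
      lintegral_const_mul _ Measurable.of_discrete, ih l, polyaProb_cons,
      sum_mul_real_eq hB hBd hBu, ← hZdef, lastMultiplicity_cons,
      ← ofReal_measureReal (measure_ne_top ν (B k))]
    simp only [sum_labelledBoxProb_cons_old hBd]
    by_cases hk : k = f (Fin.last m)
    · simp only [hk, if_true]
      rw [lintegral_add_left Measurable.of_discrete, lintegral_const_mul _ Measurable.of_discrete,
        lintegral_const_mul _ Measurable.of_discrete, ih l, ih (l - 1),
        ← ENNReal.ofReal_natCast, ← ENNReal.ofReal_natCast]
      have hadd := lastMultiplicity_add_one f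
      rw [← hadd]
      have hrec := polyaBlockMass_succ ha (lastMultiplicity f) l
      have h1 := hg (lastMultiplicity f) l
      have h2 := hg (lastMultiplicity f) (l - 1)
      rw [← ENNReal.ofReal_mul (by positivity), ← ENNReal.ofReal_mul (by positivity),
        ← ENNReal.ofReal_mul (by positivity), ← ENNReal.ofReal_mul (by positivity),
        ← ENNReal.ofReal_add (by positivity) (by positivity), ← ENNReal.ofReal_mul (by positivity),
        ← ENNReal.ofReal_add (by positivity) (by positivity)]
      congr 1
      rw [← ha_def]
      push_cast at hrec ⊢
      field_simp
      linear_combination (-Z) * hrec +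
        (-(Z * polyaBlockMass a (lastMultiplicity f) l)) * ha_def
    · simp only [hk, if_false, add_zero]
      have h1 := hg (lastMultiplicity f) l
      rw [lintegral_const_mul _ Measurable.of_discrete, ih l, ← ENNReal.ofReal_natCast,
        ← ENNReal.ofReal_mul (by positivity), ← ENNReal.ofReal_mul (by positivity),
        ← ENNReal.ofReal_mul (by positivity), ← ENNReal.ofReal_mul (by positivity),
        ← ENNReal.ofReal_add (by positivity) (by positivity)]
      congr 1
      push_cast
      field_simp

end Pattern

/-! ## The law of a sample from a Dirichlet process -/

/-- The Blackwell-MacQueen law of `m` draws from a Dirichlet process: i.i.d. values with law `ν`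
attached to the labels of a Hoppe urn. -/
noncomputable def blackwellMacQueenLaw {S : Type*} [MeasurableSpace S] (θ : ℝ) (ν : Measure S)
    (m : ℕ) : Measure (Fin m → S) :=
  (hoppeLaw θ m).bind fun r => (Measure.infinitePi fun _ : ℕ => ν).map fun y i => y (r i)

lemma lintegral_blackwellMacQueenLaw {S : Type*} [MeasurableSpace S] (θ : ℝ) (ν : Measure S)
    {m : ℕ} {F : (Fin m → S) → ℝ≥0∞} (hF : Measurable F) :
    ∫⁻ x, F x ∂(blackwellMacQueenLaw θ ν m) =
      ∫⁻ r, ∫⁻ y, F (fun i => y (r i)) ∂(Measure.infinitePi fun _ : ℕ => ν) ∂(hoppeLaw θ m) := by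
  rw [blackwellMacQueenLaw, Measure.lintegral_bind Measurable.of_discrete.aemeasurable
    hF.aemeasurable]
  exact lintegral_congr fun r => lintegral_map hF (by fun_prop)

lemma blackwellMacQueenLaw_box {S κ : Type*} [MeasurableSpace S] (θ : ℝ) (ν : Measure S) {m : ℕ}
    {B : κ → Set S} (hB : ∀ k, MeasurableSet (B k)) (f : Fin m → κ) :
    blackwellMacQueenLaw θ ν m {x | ∀ i, x i ∈ B (f i)} =
      ∫⁻ r, labelledBoxProb ν B r f ∂(hoppeLaw θ m) := by
  have hm : MeasurableSet {x : Fin m → S | ∀ i, x i ∈ B (f i)} := by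
    simp only [Set.ofPred_forall]
    exact MeasurableSet.iInter fun i => (hB (f i)).preimage (measurable_pi_apply i)
  rw [blackwellMacQueenLaw, Measure.bind_apply hm Measurable.of_discrete.aemeasurable]
  refine lintegral_congr fun r => ?_
  rw [Measure.map_apply (by fun_prop) hm]
  rfl

section Sample

variable {Ω S : Type*} [MeasurableSpace Ω] [MeasurableSpace S] {μ : Measure Ω}
  {G₀ : Measure S} [IsProbabilityMeasure G₀] {θ : ℝ} {m : ℕ}
  {P : Ω → Measure S} {X : Fin m → Ω → S}

/-- Given `P` the sample is i.i.d., so the probability is a mixed moment of the masses of the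
partition, that is, of a Dirichlet vector. -/
lemma measure_sample_mem_partition_fin (hθ : 0 < θ) (hP : IsDirichletProcess μ θ G₀ P)
    (hX : IsSampleFrom μ P X) {k : ℕ} {B : Fin k → Set S} (hB : ∀ i, MeasurableSet (B i))
    (hBd : Pairwise fun i i' => Disjoint (B i) (B i')) (hBu : ⋃ i, B i = Set.univ)
    (f : Fin m → Fin k) :
    μ {ω | ∀ i, X i ω ∈ B (f i)} = blackwellMacQueenLaw θ G₀ m {x | ∀ i, x i ∈ B (f i)} := by
  have h1 := hX.cond_iid Set.univ (fun i => B (f i)) MeasurableSet.univ fun i => hB _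
  simp only [Set.mem_univ, true_and, Set.ofPred_true, Measure.restrict_univ] at h1
  have hmeas : Measurable fun ω => fun i => (P ω).real (B i) :=
    measurable_pi_lambda _ fun i =>
      ((Measure.measurable_coe (hB i)).comp hP.measurable).ennreal_toReal
  have h2 : ∀ ω, ∏ i, P ω (B (f i)) = ∏ i, ENNReal.ofReal ((P ω).real (B (f i))) := by
    intro ω
    have := hP.isProbabilityMeasure ω
    exact Finset.prod_congr rfl fun i _ => (ofReal_measureReal (measure_ne_top _ _)).symm
  have h3 := lintegral_map (μ := μ) (f := fun z : Fin k → ℝ => ∏ i, ENNReal.ofReal (z (f i)))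
    (by fun_prop) hmeas
  have hsum := sum_mul_real_eq (ν := G₀) hB hBd hBu θ
  rw [h1, blackwellMacQueenLaw_box θ G₀ hB, lintegral_labelledBoxProb_hoppeLaw hθ hB hBd hBu,
    lintegral_congr h2, ← h3, hP.map_partition k B hB hBd hBu,
    lintegral_prod_dirichletLaw (fun i => by positivity) (by rwa [hsum])]

lemma measure_sample_mem_partition {κ : Type*} [Fintype κ] (hθ : 0 < θ)
    (hP : IsDirichletProcess μ θ G₀ P) (hX : IsSampleFrom μ P X) {B : κ → Set S}
    (hB : ∀ i, MeasurableSet (B i)) (hBd : Pairwise fun i i' => Disjoint (B i) (B i'))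
    (hBu : ⋃ i, B i = Set.univ) (f : Fin m → κ) :
    μ {ω | ∀ i, X i ω ∈ B (f i)} = blackwellMacQueenLaw θ G₀ m {x | ∀ i, x i ∈ B (f i)} := by
  let e := Fintype.equivFin κ
  have h := measure_sample_mem_partition_fin hθ hP hX (B := fun i => B (e.symm i))
    (fun i => hB _) (fun i i' hi => hBd (e.symm.injective.ne hi))
    (by rw [← hBu]; exact e.symm.surjective.iUnion_comp B) fun i => e (f i)
  simpa using h

/-- The Blackwell-MacQueen theorem: a sample from a Dirichlet process is generated by a
Hoppe urn. -/
theorem map_sample_eq_blackwellMacQueenLaw [IsProbabilityMeasure μ] (hθ : 0 < θ) (hP : IsDirichletProcess μ θ G₀ P)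
    (hX : IsSampleFrom μ P X) :
    μ.map (fun ω i => X i ω) = blackwellMacQueenLaw θ G₀ m := by
  have hXm : Measurable fun ω i => X i ω := measurable_pi_lambda _ hX.measurable
  have hpi : ∀ A : Fin m → Set S, (∀ i, MeasurableSet (A i)) →
      μ.map (fun ω i => X i ω) (Set.univ.pi A) = blackwellMacQueenLaw θ G₀ m (Set.univ.pi A) := by
    intro A hA
    -- The sides of a rectangle need not form a partition, but the fibres of the membership pattern
    -- `φ` do. The rectangle is a finite union of boxes built from these fibres.
    let φ : S → Fin m → Prop := fun x i => x ∈ A i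
    have hφ : Measurable φ := measurable_pi_lambda _ fun i => measurableSet_setOfPred.1 (hA i)
    let Φ : (Fin m → S) → Fin m → Fin m → Prop := fun x i => φ (x i)
    have hΦ : Measurable Φ := measurable_pi_lambda _ fun i => hφ.comp (measurable_pi_apply i)
    have hmap : (μ.map (fun ω i => X i ω)).map Φ = (blackwellMacQueenLaw θ G₀ m).map Φ := by
      refine Measure.ext_of_singleton fun f => ?_
      rw [Measure.map_apply hΦ (measurableSet_singleton f),
        Measure.map_apply hΦ (measurableSet_singleton f),
        Measure.map_apply hXm ((measurableSet_singleton f).preimage hΦ)]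
      have h := measure_sample_mem_partition (κ := Fin m → Prop) hθ hP hX
        (B := fun k => φ ⁻¹' {k}) (fun k => (measurableSet_singleton k).preimage hφ)
        (fun k k' hk => (Set.disjoint_singleton.2 hk).preimage φ)
        (by rw [← Set.preimage_iUnion, Set.iUnion_of_singleton, Set.preimage_univ]) f
      convert h using 2
      · ext ω
        simp [Φ, funext_iff]
      · ext x
        simp [Φ, funext_iff]
    have hset : Set.univ.pi A = Φ ⁻¹' {g | ∀ i, g i i} := by
      ext x
      simp [Φ, φ]
    rw [hset, ← Measure.map_apply hΦ MeasurableSet.of_discrete, hmap,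
      Measure.map_apply hΦ MeasurableSet.of_discrete]
  have hprob : IsProbabilityMeasure (μ.map fun ω i => X i ω) :=
    Measure.isProbabilityMeasure_map hXm.aemeasurable
  refine ext_of_generate_finite _ generateFrom_pi.symm isPiSystem_pi ?_ ?_
  · rintro _ ⟨A, hA, rfl⟩
    exact hpi A fun i => hA i (Set.mem_univ i)
  · rw [← Set.pi_univ Set.univ]
    exact hpi _ fun _ => MeasurableSet.univ

end Sample

/-! ## Sequences of i.i.d. points -/

/-- A measurable injection into the Cantor space pulls the diagonal back to a countable intersection
of measurable sets. -/
lemma measurableEq_of_countablySeparated (S : Type*) [MeasurableSpace S]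
    [MeasurableSpace.CountablySeparated S] : MeasurableEq S := by
  obtain ⟨f, hf, hinj⟩ :=
    MeasurableSpace.measurable_injection_nat_bool_of_countablySeparated S
  constructor
  have h : Set.diagonal S = {p : S × S | f p.1 = f p.2} := by
    ext p
    simp [hinj.eq_iff]
  have h2 : {p : S × S | f p.1 = f p.2} = ⋂ k, {p : S × S | f p.1 k = f p.2 k} := by
    ext p
    simp [funext_iff]
  rw [h, h2]
  exact MeasurableSet.iInter fun k =>
    measurableSet_eq_fun ((measurable_pi_apply k).comp (hf.comp measurable_fst))
      ((measurable_pi_apply k).comp (hf.comp measurable_snd))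

/-- By Fubini each diagonal is null, its slices being singletons; there are countably many pairs of
indices. -/
lemma ae_injective_infinitePi {S : Type*} [MeasurableSpace S] [MeasurableEq S] {G₀ : Measure S}
    [IsProbabilityMeasure G₀] (hG₀ : ∀ x, G₀ {x} = 0) :
    ∀ᵐ y ∂(Measure.infinitePi fun _ : ℕ => G₀), Function.Injective y := by
  have h : ∀ i k : ℕ, i ≠ k → ∀ᵐ y ∂(Measure.infinitePi fun _ : ℕ => G₀), y i ≠ y k := by
    intro i k hik
    have h1 : (Measure.infinitePi fun _ : ℕ => G₀) {y | y i = y k} = 0 := by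
      have h2 : {y : ℕ → S | y i = y k} = (fun y => (y i, y k)) ⁻¹' Set.diagonal S := rfl
      rw [h2, ← Measure.map_apply (by fun_prop) measurableSet_diagonal,
        Measure.infinitePi_map_eval_prod hik, Measure.measure_prod_null measurableSet_diagonal]
      refine ae_of_all _ fun x => ?_
      have hx : Prod.mk x ⁻¹' Set.diagonal S = {x} := by
        ext z
        simp [eq_comm]
      simpa only [hx, Pi.zero_apply] using hG₀ x
    simpa using measure_eq_zero_iff_ae_notMem.1 h1
  have h' : ∀ᵐ y ∂(Measure.infinitePi fun _ : ℕ => G₀), ∀ i k : ℕ, i ≠ k → y i ≠ y k := by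
    simp only [ae_all_iff]
    exact h
  filter_upwards [h'] with y hy i k hik
  by_contra hne
  exact hy i k hne hik

lemma measurePreserving_reindex_infinitePi {S : Type*} [MeasurableSpace S] (G₀ : Measure S)
    [IsProbabilityMeasure G₀] {σ : ℕ → ℕ} (hσ : Function.Injective σ) :
    MeasurePreserving (fun (y : ℕ → S) l => y (σ l)) (Measure.infinitePi fun _ : ℕ => G₀)
      (Measure.infinitePi fun _ : ℕ => G₀) :=
  ⟨by fun_prop, Measure.map_infinitePi_infinitePi_of_inj (P := fun _ : ℕ => G₀) hσ⟩

/-! ## Pairwise independent hash functions at i.i.d. points -/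

lemma measure_setOf_eq_sum {Ω ι : Type*} [MeasurableSpace Ω] {J : ℕ} [Fintype ι] (μ : Measure Ω)
    {g : Ω → ι → Fin J} (hg : ∀ i, Measurable fun ω => g ω i)
    (C : (ι → Fin J) → Prop) [DecidablePred C] [DecidableEq ι] :
    μ {ω | C (g ω)} = ∑ v with C v, μ {ω | ∀ i, g ω i = v i} := by
  have hg' : Measurable g := measurable_pi_lambda _ hg
  have h := sum_measure_preimage_singleton (μ := μ) (Finset.univ.filter C) (f := g)
    fun v _ => hg' (measurableSet_singleton v)
  have h1 : {ω | C (g ω)} = g ⁻¹' ↑(Finset.univ.filter C) := by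
    ext ω
    simp
  rw [h1, ← h]
  refine Finset.sum_congr rfl fun v _ => ?_
  congr 1
  ext ω
  simp [funext_iff]

section Hash

variable {Ω S : Type*} [MeasurableSpace Ω] {μ : Measure Ω} {J : ℕ} {h : Ω → S → Fin J}

lemma IsPairwiseIndependentHash.measurableSet_eq (hh : IsPairwiseIndependentHash μ h) (x : S)
    (k : Fin J) : MeasurableSet {ω | h ω x = k} :=
  hh.measurable x (measurableSet_singleton k)

variable [IsProbabilityMeasure μ]

/-- Sum the pair law over the bucket of the auxiliary second point `x'`. -/
lemma IsPairwiseIndependentHash.measureReal_eq (hh : IsPairwiseIndependentHash μ h) {x x' : S}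
    (hx : x ≠ x') (k : Fin J) : μ.real {ω | h ω x = k} = 1 / J := by
  have hJ : (J : ℝ) ≠ 0 := by exact_mod_cast k.pos.ne'
  have h1 : ∑ k' : Fin J, μ.real {ω | h ω x = k ∧ h ω x' = k'} = μ.real {ω | h ω x = k} := by
    rw [← measureReal_biUnion_finset]
    · congr 1
      ext ω
      simp
    · intro k₁ _ k₂ _ hk
      exact Set.disjoint_left.2 fun ω h₁ h₂ => hk (h₁.2.symm.trans h₂.2)
    · exact fun k' _ => (hh.measurableSet_eq x k).inter (hh.measurableSet_eq x' k')
  rw [← h1, Finset.sum_congr rfl fun k' _ => hh.pairwise x x' hx k k']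
  simp only [Finset.sum_const, Finset.card_univ, Fintype.card_fin, nsmul_eq_mul]
  field_simp

/-- The centred number of distinct points hashed to a given bucket has variance at most the
number of points. -/
lemma IsPairwiseIndependentHash.integral_sq_le (hh : IsPairwiseIndependentHash μ h) {z : ℕ → S}
    (hz : Function.Injective z) (k : Fin J) (N : ℕ) :
    ∫ ω, (∑ a ∈ Finset.range N,
      ({ω | h ω (z a) = k}.indicator (fun _ => (1 : ℝ)) ω - 1 / J)) ^ 2 ∂μ ≤ N := by
  have hJ : (0 : ℝ) < J := by exact_mod_cast k.pos
  have hm : ∀ a, MeasurableSet {ω | h ω (z a) = k} := fun a => hh.measurableSet_eq (z a) k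
  have hmarg : ∀ a, μ.real {ω | h ω (z a) = k} = 1 / J := fun a =>
    hh.measureReal_eq (hz.ne (Nat.succ_ne_self a).symm) k
  have hint : ∀ s : Set Ω, MeasurableSet s → Integrable (s.indicator fun _ => (1 : ℝ)) μ :=
    fun s hs => (integrable_const (1 : ℝ)).indicator hs
  have hI : ∀ s : Set Ω, MeasurableSet s → ∫ ω, s.indicator (fun _ => (1 : ℝ)) ω ∂μ = μ.real s :=
    fun s hs => by rw [integral_indicator_const _ hs]; simp
  have hpt : ∀ a b ω, ({ω | h ω (z a) = k}.indicator (fun _ => (1 : ℝ)) ω - 1 / J) *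
      ({ω | h ω (z b) = k}.indicator (fun _ => (1 : ℝ)) ω - 1 / J) =
      ({ω | h ω (z a) = k} ∩ {ω | h ω (z b) = k}).indicator (fun _ => (1 : ℝ)) ω -
        1 / J * {ω | h ω (z a) = k}.indicator (fun _ => (1 : ℝ)) ω -
        1 / J * {ω | h ω (z b) = k}.indicator (fun _ => (1 : ℝ)) ω + 1 / J * (1 / J) := by
    intro a b ω
    by_cases h1 : h ω (z a) = k <;> by_cases h2 : h ω (z b) = k <;>
      simp [h1, h2] <;> ring
  have hprod : ∀ a b, Integrable (fun ω =>
      ({ω | h ω (z a) = k}.indicator (fun _ => (1 : ℝ)) ω - 1 / J) *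
      ({ω | h ω (z b) = k}.indicator (fun _ => (1 : ℝ)) ω - 1 / J)) μ := by
    intro a b
    simp only [hpt]
    exact (((hint _ ((hm a).inter (hm b))).sub ((hint _ (hm a)).const_mul _)).sub
      ((hint _ (hm b)).const_mul _)).add (integrable_const _)
  have hval : ∀ a b, ∫ ω, ({ω | h ω (z a) = k}.indicator (fun _ => (1 : ℝ)) ω - 1 / J) *
      ({ω | h ω (z b) = k}.indicator (fun _ => (1 : ℝ)) ω - 1 / J) ∂μ =
      μ.real ({ω | h ω (z a) = k} ∩ {ω | h ω (z b) = k}) - 1 / J * (1 / J) := by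
    intro a b
    simp only [hpt]
    have i1 := hint _ ((hm a).inter (hm b))
    have i2 := (hint _ (hm a)).const_mul (1 / (J : ℝ))
    have i3 := (hint _ (hm b)).const_mul (1 / (J : ℝ))
    rw [integral_add, integral_sub, integral_sub, integral_const_mul, integral_const_mul,
      hI _ (hm a), hI _ (hm b), hI _ ((hm a).inter (hm b)), hmarg, hmarg]
    · simp
    exacts [i1, i2, i1.sub i2, i3, (i1.sub i2).sub i3, integrable_const _]
  -- Off the diagonal the covariance is zero by pairwise independence; only the `N` diagonal terms
  -- survive, each at most `1`.
  have hle : ∀ a b, ∫ ω, ({ω | h ω (z a) = k}.indicator (fun _ => (1 : ℝ)) ω - 1 / J) *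
      ({ω | h ω (z b) = k}.indicator (fun _ => (1 : ℝ)) ω - 1 / J) ∂μ ≤ if a = b then 1 else 0 := by
    intro a b
    rw [hval]
    have hpos : 0 ≤ 1 / (J : ℝ) * (1 / J) := by positivity
    split_ifs with hab
    · have : μ.real ({ω | h ω (z a) = k} ∩ {ω | h ω (z b) = k}) ≤ 1 := measureReal_le_one
      linarith
    · have := hh.pairwise (z a) (z b) (hz.ne hab) k k
      rw [Set.ofPred_and] at this
      rw [this]
      apply le_of_eq
      field_simp
      ring
  simp only [sq, Finset.sum_mul_sum]
  rw [integral_finsetSum _ fun a _ => integrable_finsetSum _ fun b _ => hprod a b]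
  calc _ ≤ ∑ a ∈ Finset.range N, ∑ b ∈ Finset.range N, (if a = b then (1 : ℝ) else 0) := by
        refine Finset.sum_le_sum fun a _ => ?_
        rw [integral_finsetSum _ fun b _ => hprod a b]
        exact Finset.sum_le_sum fun b _ => hle a b
    _ ≤ ∑ a ∈ Finset.range N, (1 : ℝ) := by
        refine Finset.sum_le_sum fun a ha => ?_
        rw [Finset.sum_ite_eq, if_pos ha]
    _ = N := by simp

/-- The sum is the integral over `D` of the centred count, whose first moment is at most `√N` by the
variance bound. The estimate is uniform in `D`, so `D` may encode the other hash values. -/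
lemma IsPairwiseIndependentHash.abs_sum_le (hh : IsPairwiseIndependentHash μ h) {z : ℕ → S}
    (hz : Function.Injective z) (k : Fin J) (N : ℕ) (D : Set Ω) :
    |∑ a ∈ Finset.range N, (μ.real (D ∩ {ω | h ω (z a) = k}) - μ.real D / J)| ≤ √N := by
  rcases Nat.eq_zero_or_pos N with rfl | hN
  · simp
  have hN' : (0 : ℝ) < N := by exact_mod_cast hN
  have hs : 0 < √(N : ℝ) := Real.sqrt_pos.2 hN'
  have hm : ∀ a, MeasurableSet {ω | h ω (z a) = k} := fun a => hh.measurableSet_eq (z a) k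
  set Z : Ω → ℝ := fun ω => ∑ a ∈ Finset.range N,
    ({ω | h ω (z a) = k}.indicator (fun _ => (1 : ℝ)) ω - 1 / J) with hZ
  have hterm : ∀ a, Integrable (fun ω =>
      {ω | h ω (z a) = k}.indicator (fun _ => (1 : ℝ)) ω - 1 / (J : ℝ)) μ := fun a =>
    ((integrable_const (1 : ℝ)).indicator (hm a)).sub (integrable_const _)
  have hZint : Integrable Z μ := integrable_finsetSum _ fun a _ => hterm a
  have hZbd : ∀ ω, ‖Z ω‖ ≤ N * (1 + 1 / J) := by
    intro ω
    refine (norm_sum_le _ _).trans ?_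
    have : ∀ a ∈ Finset.range N,
        ‖{ω | h ω (z a) = k}.indicator (fun _ => (1 : ℝ)) ω - 1 / (J : ℝ)‖ ≤ 1 + 1 / J := by
      intro a _
      refine (norm_sub_le _ _).trans (add_le_add ?_ ?_)
      · exact (norm_indicator_le_norm_self _ _).trans (by simp)
      · rw [Real.norm_of_nonneg (by positivity)]
    simpa [mul_add] using Finset.sum_le_sum this
  have hZ2 : Integrable (fun ω => Z ω ^ 2) μ := by
    simp only [sq]
    exact hZint.bdd_mul hZint.aestronglyMeasurable (ae_of_all _ hZbd)
  have hsum : ∑ a ∈ Finset.range N, (μ.real (D ∩ {ω | h ω (z a) = k}) - μ.real D / J) =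
      ∫ ω in D, Z ω ∂μ := by
    rw [hZ, integral_finsetSum _ fun a _ => (hterm a).integrableOn]
    refine Finset.sum_congr rfl fun a _ => ?_
    rw [integral_sub ((integrable_const (1 : ℝ)).indicator (hm a)).integrableOn
      (integrable_const _), integral_indicator_const _ (hm a), setIntegral_const,
      measureReal_restrict_apply (hm a), Set.inter_comm]
    simp [div_eq_mul_inv]
  rw [hsum]
  calc |∫ ω in D, Z ω ∂μ| ≤ ∫ ω in D, |Z ω| ∂μ := abs_integral_le_integral_abs
    _ ≤ ∫ ω, |Z ω| ∂μ := setIntegral_le_integral hZint.abs (ae_of_all _ fun ω => abs_nonneg _)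
    -- AM-GM, with weights chosen so that a second moment of `N` balances the two terms.
    _ ≤ ∫ ω, (Z ω ^ 2 / (2 * √N) + √N / 2) ∂μ := by
        refine integral_mono hZint.abs ((hZ2.div_const _).add (integrable_const _)) fun ω => ?_
        have h1 : 0 ≤ (|Z ω| - √N) ^ 2 := sq_nonneg _
        have h2 : |Z ω| ^ 2 = Z ω ^ 2 := sq_abs _
        have h3 : Z ω ^ 2 / (2 * √N) + √N / 2 = (Z ω ^ 2 + √N ^ 2) / (2 * √N) := by
          field_simp
        simp only
        rw [h3, le_div_iff₀ (by positivity)]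
        nlinarith
    _ = (∫ ω, Z ω ^ 2 ∂μ) / (2 * √N) + √N / 2 := by
        rw [integral_add (hZ2.div_const _) (integrable_const _), integral_div]
        simp
    _ ≤ N / (2 * √N) + √N / 2 := by
        gcongr
        exact hh.integral_sq_le hz k N
    _ = √N := by
        have h3 : (N : ℝ) = √N * √N := (Real.mul_self_sqrt hN'.le).symm
        rw [div_add_div _ _ (by positivity) (by positivity), div_eq_iff (by positivity)]
        nlinarith

end Hash

section Hash

variable {Ω S : Type*} [MeasurableSpace Ω] [MeasurableSpace S] {μ : Measure Ω}
  {J m : ℕ} {h : Ω → S → Fin J}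

lemma IsPairwiseIndependentHash.measurable_measure_comp (hh : IsPairwiseIndependentHash μ h)
    (hp : ∀ v : Fin m → Fin J, Measurable fun x : Fin m → S => μ {ω | ∀ i, h ω (x i) = v i})
    (C : (Fin m → Fin J) → Prop) :
    Measurable fun x : Fin m → S => μ {ω | C fun i => h ω (x i)} := by
  classical
  have hsum : ∀ x : Fin m → S, μ {ω | C fun i => h ω (x i)} =
      ∑ v with C v, μ {ω | ∀ i, h ω (x i) = v i} := fun x =>
    measure_setOf_eq_sum μ (fun i => hh.measurable (x i)) C
  simp only [hsum]
  exact Finset.measurable_fun_sum _ fun v _ => hp v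

variable [IsProbabilityMeasure μ] {G₀ : Measure S} [IsProbabilityMeasure G₀]

/-- At i.i.d. points with a nonatomic law, a pairwise independent hash function is mutually
independent: one more point may be averaged over arbitrarily many fresh points. -/
lemma IsPairwiseIndependentHash.integral_measureReal_lt [MeasurableEq S]
    (hh : IsPairwiseIndependentHash μ h) (hG₀ : ∀ x, G₀ {x} = 0)
    (hp : ∀ v : Fin m → Fin J, Measurable fun x : Fin m → S => μ {ω | ∀ i, h ω (x i) = v i})
    (u : Fin m → Fin J) {s : ℕ} (hs : s ≤ m) :
    ∫ y, μ.real {ω | ∀ i : Fin m, (i : ℕ) < s → h ω (y i) = u i}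
      ∂(Measure.infinitePi fun _ : ℕ => G₀) = (1 / (J : ℝ)) ^ s := by
  set G := Measure.infinitePi fun _ : ℕ => G₀ with hG
  set T : ℕ → (ℕ → S) → ℝ :=
    fun s y => μ.real {ω | ∀ i : Fin m, (i : ℕ) < s → h ω (y i) = u i} with hT
  have hTm : ∀ s, Measurable (T s) := by
    intro s
    have h1 := hh.measurable_measure_comp hp fun w => ∀ i : Fin m, (i : ℕ) < s → w i = u i
    exact (h1.comp (g := fun x => _) (f := fun (y : ℕ → S) (i : Fin m) => y i)
      (by fun_prop)).ennreal_toReal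
  have hTb : ∀ s y, ‖T s y‖ ≤ 1 := fun s y => by
    rw [Real.norm_of_nonneg measureReal_nonneg]
    exact measureReal_le_one
  have hTi : ∀ s, Integrable (T s) G := fun s =>
    Integrable.of_bound (hTm s).aestronglyMeasurable 1 (ae_of_all _ (hTb s))
  induction s with
  | zero => simp
  | succ s ih =>
    have hsm : s < m := hs
    have ih := ih hsm.le
    change ∫ y, T s y ∂G = _ at ih
    change ∫ y, T (s + 1) y ∂G = _
    -- The index `m + a` is not used by the first `m` points. Exchanging it with `s` preserves the
    -- product law and supplies a fresh point for the constraint `s`, for every `a`.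
    have hswap : ∀ a, MeasurePreserving
        (fun (y : ℕ → S) l => y (Equiv.swap s (m + a) l)) G G := fun a =>
      measurePreserving_reindex_infinitePi G₀ (Equiv.swap s (m + a)).injective
    have hpt : ∀ (a : ℕ) (y : ℕ → S), T (s + 1) (fun l => y (Equiv.swap s (m + a) l)) =
        μ.real ({ω | ∀ i : Fin m, (i : ℕ) < s → h ω (y i) = u i} ∩
          {ω | h ω (y (m + a)) = u ⟨s, hsm⟩}) := by
      intro a y
      have hfix : ∀ i : Fin m, (i : ℕ) < s → Equiv.swap s (m + a) i = i := fun i hi =>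
        Equiv.swap_apply_of_ne_of_ne hi.ne (by have := i.2; omega)
      simp only [hT]
      congr 1
      ext ω
      simp only [Set.mem_ofPred_eq, Set.mem_inter_iff]
      constructor
      · intro hω
        refine ⟨fun i hi => ?_, ?_⟩
        · have := hω i (by omega)
          rwa [hfix i hi] at this
        · simpa using hω ⟨s, hsm⟩ (by simp)
      · rintro ⟨hω, hω'⟩ i hi
        rcases Nat.lt_succ_iff_lt_or_eq.1 hi with hi | hi
        · rw [hfix i hi]
          exact hω i hi
        · obtain rfl : i = ⟨s, hsm⟩ := Fin.ext hi
          simpa using hω'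
    have hshift : ∀ a, ∫ y, T (s + 1) (fun l => y (Equiv.swap s (m + a) l)) ∂G =
        ∫ y, T (s + 1) y ∂G := by
      intro a
      rw [← (hswap a).map_eq, integral_map (hswap a).measurable.aemeasurable
        (hTm _).aestronglyMeasurable, (hswap a).map_eq]
    have hshifti : ∀ a, Integrable (fun y => T (s + 1) fun l => y (Equiv.swap s (m + a) l)) G :=
      fun a => (hswap a).integrable_comp_of_integrable (hTi _)
    have hbound : ∀ N : ℕ, (N : ℝ) * |∫ y, T (s + 1) y ∂G - (1 / (J : ℝ)) ^ (s + 1)| ≤ √N := by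
      intro N
      have hae : ∀ᵐ y ∂G, ‖∑ a ∈ Finset.range N,
          (T (s + 1) (fun l => y (Equiv.swap s (m + a) l)) - T s y / J)‖ ≤ √N := by
        filter_upwards [ae_injective_infinitePi hG₀] with y hy
        simp only [hpt]
        exact hh.abs_sum_le (z := fun a => y (m + a))
          (fun a b hab => by simpa using hy hab) (u ⟨s, hsm⟩) N _
      have h1 := norm_integral_le_of_norm_le_const hae
      have hdiff : ∀ a, Integrable
          (fun y => T (s + 1) (fun l => y (Equiv.swap s (m + a) l)) - T s y / J) G := fun a =>
        (hshifti a).sub ((hTi s).div_const _)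
      rw [integral_finsetSum _ fun a _ => hdiff a,
        Finset.sum_congr rfl fun a _ => (integral_sub (hshifti a) ((hTi s).div_const _)).trans
          (by rw [hshift a, integral_div, ih]), Finset.sum_const, Finset.card_range,
        nsmul_eq_mul, norm_mul, Real.norm_natCast, Real.norm_eq_abs] at h1
      rw [probReal_univ, mul_one] at h1
      convert h1 using 4
      rw [pow_succ]
      ring
    have hzero : |∫ y, T (s + 1) y ∂G - (1 / (J : ℝ)) ^ (s + 1)| = 0 := by
      by_contra hne
      have hpos : 0 < |∫ y, T (s + 1) y ∂G - (1 / (J : ℝ)) ^ (s + 1)| :=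
        lt_of_le_of_ne (abs_nonneg _) (Ne.symm hne)
      set δ := |∫ y, T (s + 1) y ∂G - (1 / (J : ℝ)) ^ (s + 1)|
      -- Taking `N = k ^ 2` in `hbound` gives `k ^ 2 * δ ≤ k`, which contradicts `k * δ > 1`.
      obtain ⟨k, hk⟩ := exists_nat_gt (1 / δ)
      have h2 := hbound (k ^ 2)
      rw [Nat.cast_pow, Real.sqrt_sq (Nat.cast_nonneg k)] at h2
      have hk0 : (0 : ℝ) < k := lt_trans (by positivity) hk
      rw [div_lt_iff₀ hpos] at hk
      nlinarith
    exact sub_eq_zero.1 (abs_eq_zero.1 hzero)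

lemma IsPairwiseIndependentHash.lintegral_measure_eq [MeasurableEq S]
    (hh : IsPairwiseIndependentHash μ h) (hG₀ : ∀ x, G₀ {x} = 0)
    (hp : ∀ v : Fin m → Fin J, Measurable fun x : Fin m → S => μ {ω | ∀ i, h ω (x i) = v i})
    (u : Fin m → Fin J) :
    ∫⁻ y, μ {ω | ∀ i : Fin m, h ω (y i) = u i} ∂(Measure.infinitePi fun _ : ℕ => G₀) =
      ENNReal.ofReal ((1 / (J : ℝ)) ^ m) := by
  have hm : Measurable fun y : ℕ → S => μ {ω | ∀ i : Fin m, h ω (y i) = u i} :=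
    (hp u).comp (g := fun x => _) (f := fun (y : ℕ → S) (i : Fin m) => y i) (by fun_prop)
  have hQ := hh.integral_measureReal_lt hG₀ hp u le_rfl
  simp only [Fin.is_lt, forall_true_left] at hQ
  rw [← hQ, ofReal_integral_eq_lintegral_ofReal]
  · simp
  · refine Integrable.of_bound (C := 1) ?_ (ae_of_all _ fun y => ?_)
    · exact hm.ennreal_toReal.aestronglyMeasurable
    · rw [Real.norm_of_nonneg measureReal_nonneg]
      exact measureReal_le_one
  · exact ae_of_all _ fun y => measureReal_nonneg

lemma uniformOn_singleton_fin (k : Fin J) :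
    uniformOn (Set.univ : Set (Fin J)) {k} = ENNReal.ofReal (1 / J) := by
  have hJ : (0 : ℝ) < J := by exact_mod_cast k.pos
  rw [uniformOn_univ, Measure.count_singleton, Fintype.card_fin, ENNReal.ofReal_div_of_pos hJ]
  simp

/-- The hash values of labelled i.i.d. points are labelled i.i.d. uniform buckets. -/
theorem IsPairwiseIndependentHash.lintegral_measure_comp_eq [MeasurableEq S] [Nonempty (Fin J)]
    (hh : IsPairwiseIndependentHash μ h) (hG₀ : ∀ x, G₀ {x} = 0)
    (hp : ∀ v : Fin m → Fin J, Measurable fun x : Fin m → S => μ {ω | ∀ i, h ω (x i) = v i})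
    {r : Fin m → ℕ} (hr : ∀ i, r i < m) (v : Fin m → Fin J) :
    ∫⁻ y, μ {ω | ∀ i, h ω (y (r i)) = v i} ∂(Measure.infinitePi fun _ : ℕ => G₀) =
      labelledBoxProb (uniformOn (Set.univ : Set (Fin J))) (fun k => {k}) r v := by
  let ρ : Fin m → Fin m := fun i => ⟨r i, hr i⟩
  -- Repeated labels repeat points, so both sides are summed over the hash vectors `u` of `m`
  -- separate points that agree with `v` along the labels.
  have h1 : ∀ y : ℕ → S, μ {ω | ∀ i, h ω (y (r i)) = v i} =
      ∑ u : Fin m → Fin J with ∀ i, u (ρ i) = v i, μ {ω | ∀ i : Fin m, h ω (y i) = u i} := fun y =>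
    measure_setOf_eq_sum μ (g := fun ω (i : Fin m) => h ω (y i))
      (fun i => hh.measurable (y i)) fun u => ∀ i, u (ρ i) = v i
  have h2 := measure_setOf_eq_sum
    (Measure.infinitePi fun _ : ℕ => uniformOn (Set.univ : Set (Fin J)))
    (g := fun y (i : Fin m) => y i) (fun i => by fun_prop) fun u => ∀ i, u (ρ i) = v i
  have h3 : ∀ u : Fin m → Fin J,
      (Measure.infinitePi fun _ : ℕ => uniformOn (Set.univ : Set (Fin J)))
        {y | ∀ i : Fin m, y i = u i} = ENNReal.ofReal ((1 / (J : ℝ)) ^ m) := by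
    intro u
    have h4 := labelledBoxProb_eq_prod (ν := uniformOn (Set.univ : Set (Fin J)))
      (B := fun k => {k}) (r := fun i : Fin m => (i : ℕ)) (f := u)
      (fun k => measurableSet_singleton k) m fun i => i.2
    simp only [labelledBoxProb, Set.mem_singleton_iff] at h4
    rw [h4, Finset.prod_range]
    have h5 : ∀ l : Fin m, (⋂ i : Fin m, ⋂ (_ : (i : ℕ) = l), ({u i} : Set (Fin J))) = {u l} := by
      intro l
      ext k
      simp [← Fin.ext_iff]
    simp only [h5, uniformOn_singleton_fin]
    rw [Finset.prod_const, Finset.card_univ, Fintype.card_fin,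
      ENNReal.ofReal_pow (by positivity)]
  have h6 : ∀ u : Fin m → Fin J,
      Measurable fun y : ℕ → S => μ {ω | ∀ i : Fin m, h ω (y i) = u i} := fun u =>
    (hp u).comp (g := fun x => _) (f := fun (y : ℕ → S) (i : Fin m) => y i) (by fun_prop)
  simp only [h1]
  rw [lintegral_finsetSum _ fun u _ => h6 u,
    Finset.sum_congr rfl fun u _ => hh.lintegral_measure_eq hG₀ hp u]
  simp only [labelledBoxProb, Set.mem_singleton_iff]
  exact (h2.trans (Finset.sum_congr rfl fun u _ => h3 u)).symm

end Hash

/-! ## The posterior law of the empirical frequency -/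

lemma measurable_lastMultiplicity {S : Type*} [MeasurableSpace S] [MeasurableEq S]
    [DecidableEq S] (n : ℕ) : Measurable fun x : Fin (n + 1) → S => lastMultiplicity x := by
  simp only [lastMultiplicity, Finset.card_filter]
  exact Finset.measurable_fun_sum _ fun i _ => Measurable.ite
    (measurableSet_eq_fun (measurable_pi_apply _) (measurable_pi_apply _)) measurable_const
    measurable_const

/-- Supplies a hash vector with the prescribed counts, hence the positivity of the conditioning
event. -/
lemma exists_card_fiber_eq {J n : ℕ} (c : Fin J → ℕ) (hc : ∑ k, c k = n) :
    ∃ w : Fin n → Fin J, ∀ k, (Finset.univ.filter fun i => w i = k).card = c k := by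
  subst hc
  refine ⟨fun i => (finSigmaFinEquiv.symm i).1, fun k => ?_⟩
  rw [Finset.card_filter, ← finSigmaFinEquiv.sum_comp, Fintype.sum_sigma]
  simp

section Posterior

variable {Ω S : Type*} [MeasurableSpace Ω] [MeasurableSpace S] {μ : Measure Ω}
  [IsProbabilityMeasure μ] {G₀ : Measure S} [IsProbabilityMeasure G₀] {θ : ℝ} {J : ℕ}
  {P : Ω → Measure S} {h : Ω → S → Fin J}

/-- The field `subst` replaces the hash by its law at fixed points; what remains is an integral
against the law of the sample. -/
lemma measure_sample_mem_and_hash_eq {m : ℕ} {X : Fin m → Ω → S} (hθ : 0 < θ)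
    (hP : IsDirichletProcess μ θ G₀ P) (hX : IsSampleFrom μ P X)
    (hind : IsHashIndependentOfSample μ P X h) {E : Set (Fin m → S)} (hE : MeasurableSet E)
    (v : Fin m → Fin J) :
    μ {ω | (fun i => X i ω) ∈ E ∧ ∀ i, h ω (X i ω) = v i} =
      ∫⁻ r, ∫⁻ y, E.indicator (fun x => μ {ω | ∀ i, h ω (x i) = v i}) (fun i => y (r i))
        ∂(Measure.infinitePi fun _ : ℕ => G₀) ∂(hoppeLaw θ m) := by
  have hXm : Measurable fun ω i => X i ω := measurable_pi_lambda _ hX.measurable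
  have h1 := hind.subst (Prod.snd ⁻¹' E) v (measurable_snd hE)
  rw [← lintegral_blackwellMacQueenLaw θ G₀ ((hind.measurable_prob v).indicator hE),
    ← map_sample_eq_blackwellMacQueenLaw hθ hP hX, lintegral_indicator hE,
    setLIntegral_map hE (hind.measurable_prob v) hXm]
  exact h1

variable {n : ℕ} {X : Fin (n + 1) → Ω → S} [MeasurableSpace.CountablySeparated S]

/-- The joint law of the hash values and the empirical frequency of the last data point. -/
theorem measure_queryFrequency_and_hash_eq (hG₀ : ∀ x, G₀ {x} = 0) (hθ : 0 < θ)
    (hP : IsDirichletProcess μ θ G₀ P) (hX : IsSampleFrom μ P X)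
    (hh : IsPairwiseIndependentHash μ h) (hind : IsHashIndependentOfSample μ P X h)
    (v : Fin (n + 1) → Fin J) (l : ℕ) :
    μ {ω | queryFrequency X ω = l ∧ ∀ i, h ω (X i ω) = v i} =
      ENNReal.ofReal (polyaBlockMass (θ / J) (lastMultiplicity v) l *
        polyaProb (fun _ => θ / J) v) := by
  classical
  have := measurableEq_of_countablySeparated S
  have : Nonempty (Fin J) := ⟨v 0⟩
  have hJ : (0 : ℝ) < J := by exact_mod_cast (v 0).pos
  have hE : MeasurableSet {x : Fin (n + 1) → S | lastMultiplicity x = l} :=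
    measurable_lastMultiplicity n (measurableSet_singleton l)
  have hν : ∀ k : Fin J, (uniformOn (Set.univ : Set (Fin J))).real {k} = 1 / J := fun k => by
    rw [measureReal_def, uniformOn_singleton_fin, ENNReal.toReal_ofReal (by positivity)]
  have h1 := lintegral_lastMultiplicity_hoppeLaw (ν := uniformOn (Set.univ : Set (Fin J)))
    (B := fun k => {k}) hθ (fun k => measurableSet_singleton k)
    (fun k k' hk => Set.disjoint_singleton.2 hk) (Set.iUnion_of_singleton _) v
    (by rw [hν]; positivity) l
  simp only [hν, mul_one_div] at h1
  rw [← h1]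
  have h2 : {ω | queryFrequency X ω = l ∧ ∀ i, h ω (X i ω) = v i} =
      {ω | (fun i => X i ω) ∈ {x : Fin (n + 1) → S | lastMultiplicity x = l} ∧
        ∀ i, h ω (X i ω) = v i} := by
    ext ω
    simp only [queryFrequency, lastMultiplicity, Set.mem_ofPred_eq]
  rw [h2, measure_sample_mem_and_hash_eq hθ hP hX hind hE v]
  refine lintegral_congr_ae ?_
  filter_upwards [ae_hoppeLaw_lt θ (n + 1)] with r hr
  rw [← hh.lintegral_measure_comp_eq hG₀ hind.measurable_prob hr v]
  -- For injective `y` the ties among the points `y (r i)` are exactly those among the labels `r i`.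
  have h3 : ∀ᵐ y ∂(Measure.infinitePi fun _ : ℕ => G₀),
      {x : Fin (n + 1) → S | lastMultiplicity x = l}.indicator
        (fun x => μ {ω | ∀ i, h ω (x i) = v i}) (fun i => y (r i)) =
      if lastMultiplicity r = l then μ {ω | ∀ i, h ω (y (r i)) = v i} else 0 := by
    filter_upwards [ae_injective_infinitePi hG₀] with y hy
    simp only [Set.indicator_apply, Set.mem_ofPred_eq, lastMultiplicity_comp hy]
  rw [lintegral_congr_ae h3]
  split_ifs
  · rfl
  · simp

theorem measure_hash_eq (hG₀ : ∀ x, G₀ {x} = 0) (hθ : 0 < θ)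
    (hP : IsDirichletProcess μ θ G₀ P) (hX : IsSampleFrom μ P X)
    (hh : IsPairwiseIndependentHash μ h) (hind : IsHashIndependentOfSample μ P X h)
    (v : Fin (n + 1) → Fin J) :
    μ {ω | ∀ i, h ω (X i ω) = v i} = ENNReal.ofReal (polyaProb (fun _ => θ / J) v) := by
  have := measurableEq_of_countablySeparated S
  have : Nonempty (Fin J) := ⟨v 0⟩
  have hν : ∀ k : Fin J, (uniformOn (Set.univ : Set (Fin J))).real {k} = 1 / J := fun k => by
    rw [measureReal_def, uniformOn_singleton_fin, ENNReal.toReal_ofReal (by positivity)]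
  have h1 := lintegral_labelledBoxProb_hoppeLaw (ν := uniformOn (Set.univ : Set (Fin J)))
    (B := fun k => {k}) hθ (fun k => measurableSet_singleton k)
    (fun k k' hk => Set.disjoint_singleton.2 hk) (Set.iUnion_of_singleton _) v
  simp only [hν, mul_one_div] at h1
  have h2 := measure_sample_mem_and_hash_eq hθ hP hX hind MeasurableSet.univ v
  simp only [Set.mem_univ, true_and, Set.indicator_univ] at h2
  rw [← h1, h2]
  refine lintegral_congr_ae ?_
  filter_upwards [ae_hoppeLaw_lt θ (n + 1)] with r hr
  exact hh.lintegral_measure_comp_eq hG₀ hind.measurable_prob hr v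

/-- Conditionally on an event of hash values that determines the number of earlier data points in
the bucket of the last one, the empirical frequency of the last data point is Beta-Binomial. -/
theorem cond_hash_queryFrequency (hG₀ : ∀ x, G₀ {x} = 0) (hθ : 0 < θ)
    (hP : IsDirichletProcess μ θ G₀ P) (hX : IsSampleFrom μ P X)
    (hh : IsPairwiseIndependentHash μ h) (hind : IsHashIndependentOfSample μ P X h)
    {C : (Fin (n + 1) → Fin J) → Prop} {c : ℕ} (hC : ∀ v, C v → lastMultiplicity v = c)
    (hne : ∃ v, C v) :
    0 < μ {ω | C fun i => h ω (X i ω)} ∧ ∀ l,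
      (μ[|{ω | C fun i => h ω (X i ω)}]).real {ω | queryFrequency X ω = l} =
        polyaBlockMass (θ / J) c l := by
  classical
  obtain ⟨v₀, hv₀⟩ := hne
  have := measurableEq_of_countablySeparated S
  have hJ : (0 : ℝ) < J := by exact_mod_cast (v₀ 0).pos
  have hJ' : Nonempty (Fin J) := ⟨v₀ 0⟩
  have hZ : ∀ v : Fin (n + 1) → Fin J, 0 < polyaProb (fun _ => θ / J) v := fun v =>
    polyaProb_pos (fun _ => by positivity)
      (Finset.sum_pos (fun _ _ => by positivity) Finset.univ_nonempty) v
  have hg : Measurable fun ω i => h ω (X i ω) := measurable_pi_lambda _ hind.measurable_hash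
  have hA : MeasurableSet {ω | C fun i => h ω (X i ω)} :=
    hg (MeasurableSet.of_discrete (s := {v | C v}))
  have hF : ∀ l, MeasurableSet {ω | queryFrequency X ω = l} := fun l =>
    ((measurable_lastMultiplicity n).comp (measurable_pi_lambda _ hX.measurable))
      (measurableSet_singleton l)
  have hpos : 0 < μ {ω | C fun i => h ω (X i ω)} := by
    refine lt_of_lt_of_le ?_ (measure_mono (s := {ω | ∀ i, h ω (X i ω) = v₀ i}) ?_)
    · rw [measure_hash_eq hG₀ hθ hP hX hh hind]
      exact ENNReal.ofReal_pos.2 (hZ v₀)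
    · intro ω hω
      have : (fun i => h ω (X i ω)) = v₀ := funext hω
      simpa [this] using hv₀
  refine ⟨hpos, fun l => ?_⟩
  have hb := polyaBlockMass_nonneg (a := θ / J) (by positivity) c l
  have h1 := measure_setOf_eq_sum (μ.restrict {ω | queryFrequency X ω = l})
    (g := fun ω i => h ω (X i ω)) hind.measurable_hash C
  have h2 := measure_setOf_eq_sum μ (g := fun ω i => h ω (X i ω)) hind.measurable_hash C
  -- By `hC` all hash vectors in the event share the same count `c`, so the factor `polyaBlockMass`
  -- is common and leaves the sum.
  have h3 : ∀ v ∈ Finset.univ.filter C,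
      (μ.restrict {ω | queryFrequency X ω = l}) {ω | ∀ i, h ω (X i ω) = v i} =
        ENNReal.ofReal (polyaBlockMass (θ / J) c l) * μ {ω | ∀ i, h ω (X i ω) = v i} := by
    intro v hv
    have hm : MeasurableSet {ω | ∀ i, h ω (X i ω) = v i} := by
      convert hg (measurableSet_singleton v) using 1
      ext ω
      simp [funext_iff]
    rw [Measure.restrict_apply hm, Set.inter_comm, ← Set.ofPred_and,
      measure_queryFrequency_and_hash_eq hG₀ hθ hP hX hh hind, hC v (by simpa using hv),
      measure_hash_eq hG₀ hθ hP hX hh hind, ENNReal.ofReal_mul hb]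
  rw [Finset.sum_congr rfl h3, ← Finset.mul_sum, ← h2, Measure.restrict_apply hA] at h1
  rw [measureReal_def, cond_apply hA, h1, ENNReal.toReal_mul, ENNReal.toReal_mul,
    ENNReal.toReal_inv, ENNReal.toReal_ofReal hb]
  have := (ENNReal.toReal_pos hpos.ne' (measure_ne_top μ _)).ne'
  field_simp

end Posterior

theorem mainTheorem2 {Ω S : Type*} [MeasurableSpace Ω] [MeasurableSpace S]
    [MeasurableSpace.CountablySeparated S]
    (μ : Measure Ω) [IsProbabilityMeasure μ]
    (G₀ : Measure S) [IsProbabilityMeasure G₀] (hG₀ : ∀ x, G₀ {x} = 0)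
    (θ : ℝ) (hθ : 0 < θ) (n J : ℕ)
    (P : Ω → Measure S) (X : Fin (n + 1) → Ω → S) (h : Ω → S → Fin J)
    (hP : IsDirichletProcess μ θ G₀ P)
    (hX : IsSampleFrom μ P X)
    (hh : IsPairwiseIndependentHash μ h)
    (hind : IsHashIndependentOfSample μ P X h)
    (c : Fin J → ℕ) (hc : ∑ k, c k = n) (j : Fin J) :
    -- the conditioning event `{C_J = c, h(Xₙ₊₁) = j}` has positive probability
    0 < μ {ω | sketch h X ω = c ∧ queryBucket h X ω = j} ∧
    -- the closed form, which is also the value of the Poisson-Kingman formula at the Gamma CRM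
    (∀ l ≤ c j,
      (μ[|{ω | sketch h X ω = c ∧ queryBucket h X ω = j}]).real {ω | queryFrequency X ω = l} =
          θ / J * (risingFactorial ((c j : ℝ) - l + 1) l /
            risingFactorial (θ / J + (c j : ℝ) - l) (l + 1)) ∧
      (μ[|{ω | sketch h X ω = c ∧ queryBucket h X ω = j}]).real {ω | queryFrequency X ω = l} =
          pkPosterior θ gammaLevyDensity 0 0 n c j l) ∧
    -- the posterior law is Beta-Binomial, with `c j` trials and a `Beta(1, θ / J)` mixing law
    (∀ l : ℕ,
      (μ[|{ω | sketch h X ω = c ∧ queryBucket h X ω = j}]).real {ω | queryFrequency X ω = l} =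
          betaBinomialMass (c j) 1 (θ / J) l) ∧
    -- it depends on the sketch only through the count in the bucket of `Xₙ₊₁`
    (∀ l : ℕ,
      (μ[|{ω | sketch h X ω = c ∧ queryBucket h X ω = j}]).real {ω | queryFrequency X ω = l} =
        (μ[|{ω | sketch h X ω (queryBucket h X ω) = c j}]).real
          {ω | queryFrequency X ω = l}) := by
  have hJ : (0 : ℝ) < J := by exact_mod_cast j.pos
  have ha : 0 < θ / J := by positivity
  have hlast : ∀ v : Fin (n + 1) → Fin J,
      ((fun k => (Finset.univ.filter fun i : Fin n => v i.castSucc = k).card) = c ∧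
        v (Fin.last n) = j) → lastMultiplicity v = c j := by
    rintro v ⟨hv, hvj⟩
    rw [lastMultiplicity, hvj, ← congrFun hv j]
  obtain ⟨v, hv⟩ : ∃ v : Fin (n + 1) → Fin J,
      (fun k => (Finset.univ.filter fun i : Fin n => v i.castSucc = k).card) = c ∧
        v (Fin.last n) = j := by
    obtain ⟨w, hw⟩ := exists_card_fiber_eq c hc
    exact ⟨Fin.snoc w j, funext fun k => by simpa using hw k, by simp⟩
  obtain ⟨hpos, hpost⟩ := cond_hash_queryFrequency hG₀ hθ hP hX hh hind hlast ⟨v, hv⟩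
  -- The coarser event, fixing only the count in the query bucket, determines the same number and so
  -- yields the same mass.
  obtain ⟨-, hpost'⟩ := cond_hash_queryFrequency hG₀ hθ hP hX hh hind
    (C := fun v => lastMultiplicity v = c j) (fun _ hv => hv) ⟨v, hlast v hv⟩
  refine ⟨hpos, fun l hl => ⟨?_, ?_⟩, fun l => ?_, fun l => ?_⟩
  · exact (hpost l).trans (polyaBlockMass_eq ha hl)
  · exact (hpost l).trans (pkPosterior_gammaLevyDensity hθ hc j hl).symm
  · exact (hpost l).trans (betaBinomialMass_one ha (c j) l).symm
  · exact (hpost l).trans (hpost' l).symm
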